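/- Let $\lambda$ be a regular cardinal. Call an object $C$ of a category $V$ *connected* if the representable $V(C,-)$ preserves all small coproducts (including the empty one), and *$\lambda$-presentable* if $V(C,-)$ preserves all $\lambda$-filtered colimits. A category $J$ is *$\lambda$-c-filtered* if every functor $K\to J$ from a connected (in particular non-empty) category $K$ with fewer than $\lambda$ arrows admits a cocone. A locally small category $V$ is *locally $\lambda$-c-presentable* if it is cocomplete and there is a (small) set $\mathcal S$ of objects of $V$ that are both connected and $\lambda$-presentable, such that every object of $V$ is the colimit of a small $\lambda$-c-filtered diagram of objects of $\mathcal S$; for $\lambda=\aleph_0$ one says *locally finitely c-presentable*. For $0\le n\le\omega$, let $\mathcal T_{\le n}$ be the monad on the category $\widehat{\mathbb G}_{\le n}$ of $n$-globular sets (presheaves on the category of globes of dimension $\le n$) induced by the adjunction between the forgetful functor from strict $n$-categories and the free strict $n$-category functor. An *$n$-operad* is a monad $A$ on $\widehat{\mathbb G}_{\le n}$ together with a morphism of monads $A\to\mathcal T_{\le n}$ all of whose naturality squares are pullbacks; its algebras are the algebras of the monad $A$. **Theorem.** (1) If $V$ is locally $\lambda$-c-presentable and $T$ is a monad on $V$ whose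 underlying endofunctor preserves $\lambda$-filtered colimits and small coproducts, then the category $V^T$ of Eilenberg–Moore algebras is locally $\lambda$-c-presentable. (2) In particular, for every $0\le n\le\omega$ and every $n$-operad $A$, the category of algebras of $A$ is locally finitely c-presentable. -/

import Mathlib

open CategoryTheory Limits Opposite

universe w v u

/-! ### Connected objects and locally `κ`-c-presentable categories -/

namespace CPres

/-- An object `C` is connected when the representable `V(C, -)` preserves (small) coproducts,
including the empty one. -/
def IsConnectedObject {V : Type u} [Category.{w} V] (C : V) : Prop :=
  ∀ ι : Type w, PreservesColimitsOfShape (Discrete ι) (coyoneda.obj (op C))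

/-- A functor preserves (small) coproducts. -/
def PreservesSmallCoproducts {V : Type u} [Category.{w} V] {W : Type v} [Category.{w} W]
    (F : V ⥤ W) : Prop :=
  ∀ ι : Type w, PreservesColimitsOfShape (Discrete ι) F

/-- A category `J` is `κ`-c-filtered when every functor to `J` from a `κ`-small connected
(in particular nonempty) category admits a cocone. -/
class IsCardinalCFiltered (J : Type u) [Category.{v} J] (κ : Cardinal.{w}) [Fact κ.IsRegular] :
    Prop where
  nonempty_cocone {A : Type w} [SmallCategory A] [IsConnected A] (F : A ⥤ J)
    (hA : HasCardinalLT (Arrow A) κ) : Nonempty (Cocone F)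

/-- A locally small category `V` (its hom-sets live in `Type w`, the universe of small sets) is
locally `κ`-c-presentable when it is cocomplete and has a small set `S` of objects which are
connected and `κ`-presentable, such that every object of `V` is the colimit of a small
`κ`-c-filtered diagram of objects of `S`. -/
class IsLocallyCPresentable (V : Type u) [Category.{w} V] (κ : Cardinal.{w})
    [Fact κ.IsRegular] : Prop where
  cocomplete : HasColimitsOfSize.{w, w} V
  exists_generator : ∃ S : ObjectProperty V, ObjectProperty.Small.{w} S ∧
    (∀ X, S X → IsConnectedObject X ∧ IsCardinalPresentable X κ) ∧
    ∀ X : V, ∃ (J : Type w) (_ : SmallCategory J),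
      IsCardinalCFiltered J κ ∧ Nonempty (S.ColimitOfShape J X)

/-- Locally finitely c-presentable: locally `ℵ₀`-c-presentable. -/
def IsLocallyFinitelyCPresentable (V : Type u) [Category.{w} V] : Prop :=
  haveI := Cardinal.fact_isRegular_aleph0.{w}
  IsLocallyCPresentable V Cardinal.aleph0.{w}

end CPres

/-! ### `n`-globular sets, for `0 ≤ n ≤ ω` -/

namespace Glob

/-- The objects of the globe category `𝔾_{≤n}`: natural numbers `k ≤ n`
(with `n = ⊤` standing for `ω`). -/
@[ext]
structure Globe (n : ℕ∞) where
  dim : ℕ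
  dim_le : (dim : ℕ∞) ≤ n

variable {n : ℕ∞}

/-- The morphisms of the globe category. For `k < l` there are exactly two morphisms `k ⟶ l`,
the inclusions of the `k`-globe as the `k`-dimensional source (sign `-1`) and as the
`k`-dimensional target (sign `1`) of the `l`-globe; for `k = l` there is only the identity
(sign `0`); for `k > l` there is none. -/
@[ext]
structure Globe.Hom (k l : Globe n) where
  sign : SignType
  cond : (sign = 0 ∧ k.dim = l.dim) ∨ (sign ≠ 0 ∧ k.dim < l.dim)

/-- Composition obeys the (co)globular identities: a composite of two non-identity maps is the
source or target inclusion according to the first of them. -/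
instance : Category (Globe n) where
  Hom := Globe.Hom
  id k := ⟨0, Or.inl ⟨rfl, rfl⟩⟩
  comp f g := ⟨if f.sign = 0 then g.sign else f.sign, by
    rcases f.cond with ⟨h, e⟩ | ⟨h, e⟩ <;> rcases g.cond with ⟨h', e'⟩ | ⟨h', e'⟩ <;>
      simp [h, h'] <;> omega⟩
  id_comp f := by apply Globe.Hom.ext; simp
  comp_id f := by
    apply Globe.Hom.ext
    by_cases h : f.sign = 0 <;> simp [h]
  assoc f g h := by
    apply Globe.Hom.ext
    by_cases h : f.sign = 0 <;> simp [h]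

/-- The inclusion of the `k`-globe as the `k`-source of the `l`-globe. -/
def srcIncl {k l : Globe n} (h : k.dim < l.dim) : k ⟶ l :=
  Globe.Hom.mk (-1) (Or.inr ⟨by decide, h⟩)

/-- The inclusion of the `k`-globe as the `k`-target of the `l`-globe. -/
def tgtIncl {k l : Globe n} (h : k.dim < l.dim) : k ⟶ l :=
  Globe.Hom.mk 1 (Or.inr ⟨by decide, h⟩)

/-- The category of `n`-globular sets: presheaves on the globe category. -/
abbrev NGlob (n : ℕ∞) := (Globe n)ᵒᵖ ⥤ Type u

/-- The set of `k`-cells. -/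
abbrev NGlob.cell (X : NGlob.{u} n) (k : Globe n) : Type u := X.obj (op k)

/-- The `k`-dimensional source of an `l`-cell. -/
def NGlob.src (X : NGlob.{u} n) {k l : Globe n} (h : k.dim < l.dim) (x : X.cell l) : X.cell k :=
  X.map (srcIncl h).op x

/-- The `k`-dimensional target of an `l`-cell. -/
def NGlob.tgt (X : NGlob.{u} n) {k l : Globe n} (h : k.dim < l.dim) (x : X.cell l) : X.cell k :=
  X.map (tgtIncl h).op x

/-! ### Strict `n`-categories -/

/-- A (small) strict `n`-category, `0 ≤ n ≤ ω`: an `n`-globular set with, for `k < l`, identity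
`l`-cells on `k`-cells, and composites along `k`-cells of those pairs `x`, `y` of `l`-cells for
which the `k`-target of `x` is the `k`-source of `y`. Compositions are written in diagrammatic
order. The composability hypotheses `e`, `e'`, ... in the axioms are in each case the ones needed
for both sides to make sense; those beyond the evident ones follow from the globular identities
and the axioms on sources and targets. -/
structure StrictNCat (n : ℕ∞) where
  /-- the underlying globular set -/
  cells : NGlob.{u} n
  /-- the identity `l`-cell on a `k`-cell -/
  ident {k l : Globe n} (h : k.dim < l.dim) (x : cells.cell k) : cells.cell l
  /-- the composite of `l`-cells along a `k`-cell -/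
  comp {k l : Globe n} (h : k.dim < l.dim) (x y : cells.cell l)
    (e : cells.tgt h x = cells.src h y) : cells.cell l
  src_ident {k l : Globe n} (h : k.dim < l.dim) (x : cells.cell k) :
    cells.src h (ident h x) = x
  tgt_ident {k l : Globe n} (h : k.dim < l.dim) (x : cells.cell k) :
    cells.tgt h (ident h x) = x
  ident_ident {k l m : Globe n} (h : k.dim < l.dim) (h' : l.dim < m.dim) (x : cells.cell k) :
    ident h' (ident h x) = ident (h.trans h') x
  src_comp {k l : Globe n} (h : k.dim < l.dim) (x y : cells.cell l)
    (e : cells.tgt h x = cells.src h y) : cells.src h (comp h x y e) = cells.src h x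
  tgt_comp {k l : Globe n} (h : k.dim < l.dim) (x y : cells.cell l)
    (e : cells.tgt h x = cells.src h y) : cells.tgt h (comp h x y e) = cells.tgt h y
  src_comp_of_lt {k j l : Globe n} (h : k.dim < j.dim) (h' : j.dim < l.dim) (x y : cells.cell l)
    (e : cells.tgt (h.trans h') x = cells.src (h.trans h') y)
    (e' : cells.tgt h (cells.src h' x) = cells.src h (cells.src h' y)) :
    cells.src h' (comp (h.trans h') x y e) = comp h (cells.src h' x) (cells.src h' y) e'
  tgt_comp_of_lt {k j l : Globe n} (h : k.dim < j.dim) (h' : j.dim < l.dim) (x y : cells.cell l)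
    (e : cells.tgt (h.trans h') x = cells.src (h.trans h') y)
    (e' : cells.tgt h (cells.tgt h' x) = cells.src h (cells.tgt h' y)) :
    cells.tgt h' (comp (h.trans h') x y e) = comp h (cells.tgt h' x) (cells.tgt h' y) e'
  /-- associativity -/
  assoc {k l : Globe n} (h : k.dim < l.dim) (x y z : cells.cell l)
    (e₁ : cells.tgt h x = cells.src h y) (e₂ : cells.tgt h y = cells.src h z)
    (e₃ : cells.tgt h (comp h x y e₁) = cells.src h z)
    (e₄ : cells.tgt h x = cells.src h (comp h y z e₂)) :
    comp h (comp h x y e₁) z e₃ = comp h x (comp h y z e₂) e₄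
  /-- left unit law -/
  ident_comp {k l : Globe n} (h : k.dim < l.dim) (x : cells.cell l)
    (e : cells.tgt h (ident h (cells.src h x)) = cells.src h x) :
    comp h (ident h (cells.src h x)) x e = x
  /-- right unit law -/
  comp_ident {k l : Globe n} (h : k.dim < l.dim) (x : cells.cell l)
    (e : cells.tgt h x = cells.src h (ident h (cells.tgt h x))) :
    comp h x (ident h (cells.tgt h x)) e = x
  /-- binary interchange -/
  interchange {k j l : Globe n} (h : k.dim < j.dim) (h' : j.dim < l.dim)
    (x y x' y' : cells.cell l)
    (e₁ : cells.tgt h' x = cells.src h' y) (e₂ : cells.tgt h' x' = cells.src h' y')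
    (e₃ : cells.tgt (h.trans h') x = cells.src (h.trans h') x')
    (e₄ : cells.tgt (h.trans h') y = cells.src (h.trans h') y')
    (e₅ : cells.tgt (h.trans h') (comp h' x y e₁) = cells.src (h.trans h') (comp h' x' y' e₂))
    (e₆ : cells.tgt h' (comp (h.trans h') x x' e₃) = cells.src h' (comp (h.trans h') y y' e₄)) :
    comp (h.trans h') (comp h' x y e₁) (comp h' x' y' e₂) e₅ =
      comp h' (comp (h.trans h') x x' e₃) (comp (h.trans h') y y' e₄) e₆
  /-- nullary interchange -/
  ident_comp_ident {k j l : Globe n} (h : k.dim < j.dim) (h' : j.dim < l.dim)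
    (x y : cells.cell j) (e : cells.tgt h x = cells.src h y)
    (e' : cells.tgt (h.trans h') (ident h' x) = cells.src (h.trans h') (ident h' y)) :
    comp (h.trans h') (ident h' x) (ident h' y) e' = ident h' (comp h x y e)

/-- A strict `n`-functor: a map of globular sets preserving identities and composites. -/
@[ext]
structure StrictNCat.Hom (C D : StrictNCat.{u} n) where
  map : C.cells ⟶ D.cells
  map_ident {k l : Globe n} (h : k.dim < l.dim) (x : C.cells.cell k) :
    map.app (op l) (C.ident h x) = D.ident h (map.app (op k) x)
  map_comp {k l : Globe n} (h : k.dim < l.dim) (x y : C.cells.cell l)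
    (e : C.cells.tgt h x = C.cells.src h y)
    (e' : D.cells.tgt h (map.app (op l) x) = D.cells.src h (map.app (op l) y)) :
    map.app (op l) (C.comp h x y e) = D.comp h (map.app (op l) x) (map.app (op l) y) e'

lemma NGlob.map_src {X Y : NGlob.{u} n} (f : X ⟶ Y) {k l : Globe n} (h : k.dim < l.dim)
    (x : X.cell l) : f.app (op k) (X.src h x) = Y.src h (f.app (op l) x) :=
  NatTrans.naturality_apply f (srcIncl h).op x

lemma NGlob.map_tgt {X Y : NGlob.{u} n} (f : X ⟶ Y) {k l : Globe n} (h : k.dim < l.dim)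
    (x : X.cell l) : f.app (op k) (X.tgt h x) = Y.tgt h (f.app (op l) x) :=
  NatTrans.naturality_apply f (tgtIncl h).op x

lemma NGlob.map_composable {X Y : NGlob.{u} n} (f : X ⟶ Y) {k l : Globe n} (h : k.dim < l.dim)
    {x y : X.cell l} (e : X.tgt h x = X.src h y) :
    Y.tgt h (f.app (op l) x) = Y.src h (f.app (op l) y) := by
  rw [← NGlob.map_src, ← NGlob.map_tgt, e]

/-- The category of strict `n`-categories and strict `n`-functors. -/
instance : Category (StrictNCat.{u} n) where
  Hom := StrictNCat.Hom
  id C := ⟨𝟙 _, by simp, by simp⟩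
  comp {C D E} F G := ⟨F.map ≫ G.map, by simp [F.map_ident, G.map_ident], by
    intro k l h x y e e'
    have e₁ := NGlob.map_composable F.map h e
    have e₂ := NGlob.map_composable G.map h e₁
    simp only [NatTrans.comp_app_apply]
    rw [F.map_comp h x y e e₁, G.map_comp h _ _ e₁ e₂]⟩

/-- The functor from strict `n`-categories to `n`-globular sets. -/
def StrictNCat.forget (n : ℕ∞) : StrictNCat.{u} n ⥤ NGlob.{u} n where
  obj C := C.cells
  map F := F.map

/-! ### Free strict `n`-categories -/

namespace Free

/-- Formal expressions in the operations of strict `n`-categories, with variables in `X`. -/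
inductive Term (X : NGlob.{u} n) : Globe n → Type u
  | var {k : Globe n} (x : X.cell k) : Term X k
  | face {k l : Globe n} (f : k ⟶ l) (t : Term X l) : Term X k
  | ident {k l : Globe n} (h : k.dim < l.dim) (t : Term X k) : Term X l
  | comp {k l : Globe n} (h : k.dim < l.dim) (s t : Term X l) : Term X l

variable {X : NGlob.{u} n}

open Classical in
/-- The value of an expression in a strict `n`-category `C`, for a given interpretation of the
variables; undefined if a composite of non-composable cells occurs. -/
noncomputable def eval (C : StrictNCat.{u} n) (φ : X ⟶ C.cells) :
    {k : Globe n} → Term X k → Option (C.cells.cell k)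
  | _, .var x => some (φ.app _ x)
  | _, .face f t => (eval C φ t).map (fun x => C.cells.map f.op x)
  | _, .ident h t => (eval C φ t).map (C.ident h)
  | _, .comp h s t => (eval C φ s).bind fun x => (eval C φ t).bind fun y =>
      if e : C.cells.tgt h x = C.cells.src h y then some (C.comp h x y e) else none

lemma eval_hom {C D : StrictNCat.{u} n} (φ : X ⟶ C.cells) (F : C ⟶ D) {k : Globe n}
    (t : Term X k) : ∀ x, eval C φ t = some x →
      eval D (φ ≫ (StrictNCat.forget n).map F) t = some ((StrictNCat.Hom.map F).app _ x) := by
  induction t with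
  | var x =>
    intro y hy
    simp only [eval, Option.some.injEq] at hy ⊢
    subst hy
    rfl
  | face f t ih =>
    intro y hy
    simp only [eval, Option.map_eq_some_iff] at hy ⊢
    obtain ⟨a, ha, rfl⟩ := hy
    exact ⟨_, ih a ha, (NatTrans.naturality_apply (StrictNCat.Hom.map F) f.op a).symm⟩
  | ident h t ih =>
    intro y hy
    simp only [eval, Option.map_eq_some_iff] at hy ⊢
    obtain ⟨a, ha, rfl⟩ := hy
    exact ⟨_, ih a ha, (StrictNCat.Hom.map_ident F h a).symm⟩
  | comp h s t ihs iht =>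
    intro y hy
    simp only [eval, Option.bind_eq_some_iff] at hy ⊢
    obtain ⟨a, ha, b, hb, hy⟩ := hy
    refine ⟨_, ihs a ha, _, iht b hb, ?_⟩
    split_ifs at hy with e
    have e' := NGlob.map_composable (StrictNCat.Hom.map F) h e
    rw [dif_pos e']
    simp only [Option.some.injEq] at hy ⊢
    subst hy
    exact (StrictNCat.Hom.map_comp F h a b e e').symm

/-- An expression is valid if it has a value under every interpretation. -/
def Valid {k : Globe n} (t : Term X k) : Prop :=
  ∀ (C : StrictNCat.{u} n) (φ : X ⟶ C.cells), ∃ x, eval C φ t = some x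

/-- Two valid expressions are identified if they agree under every interpretation. -/
def rel (X : NGlob.{u} n) (k : Globe n) : Setoid {t : Term X k // Valid t} where
  r s t := ∀ (C : StrictNCat.{u} n) (φ : X ⟶ C.cells), eval C φ s.1 = eval C φ t.1
  iseqv := ⟨fun _ _ _ => rfl, fun h C φ => (h C φ).symm,
    fun h h' C φ => (h C φ).trans (h' C φ)⟩

/-- The `k`-cells of the free strict `n`-category on `X`. -/
def Cell (X : NGlob.{u} n) (k : Globe n) : Type u := Quotient (rel X k)

/-- A representing expression. -/
noncomputable def Cell.term {k : Globe n} (q : Cell X k) : Term X k := (Quotient.out q).1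

lemma Cell.valid {k : Globe n} (q : Cell X k) : Valid q.term := (Quotient.out q).2

/-- The value of a cell under an interpretation. -/
noncomputable def Cell.val {k : Globe n} (q : Cell X k) (C : StrictNCat.{u} n)
    (φ : X ⟶ C.cells) : C.cells.cell k := (q.valid C φ).choose

lemma Cell.eval_term {k : Globe n} (q : Cell X k) (C : StrictNCat.{u} n) (φ : X ⟶ C.cells) :
    eval C φ q.term = some (q.val C φ) := (q.valid C φ).choose_spec

lemma Cell.ext {k : Globe n} {q r : Cell X k}
    (h : ∀ (C : StrictNCat.{u} n) (φ : X ⟶ C.cells), q.val C φ = r.val C φ) : q = r := by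
  rw [← Quotient.out_eq q, ← Quotient.out_eq r]
  refine Quotient.sound fun C φ => ?_
  have h₁ := q.eval_term C φ
  have h₂ := r.eval_term C φ
  rw [h C φ] at h₁
  exact h₁.trans h₂.symm

/-- The cell given by an expression with prescribed values. -/
def Cell.mk {k : Globe n} (t : Term X k)
    (v : ∀ (C : StrictNCat.{u} n), (X ⟶ C.cells) → C.cells.cell k)
    (h : ∀ C φ, eval C φ t = some (v C φ)) : Cell X k :=
  Quotient.mk (rel X k) ⟨t, fun C φ => ⟨_, h C φ⟩⟩

lemma Cell.val_mk {k : Globe n} (t : Term X k)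
    (v : ∀ (C : StrictNCat.{u} n), (X ⟶ C.cells) → C.cells.cell k)
    (h : ∀ C φ, eval C φ t = some (v C φ)) (C : StrictNCat.{u} n) (φ : X ⟶ C.cells) :
    (Cell.mk t v h).val C φ = v C φ := by
  have h₁ := (Cell.mk t v h).eval_term C φ
  have h₂ : eval C φ (Cell.mk t v h).term = eval C φ t :=
    Quotient.mk_out (s := rel X k) ⟨t, fun C φ => ⟨_, h C φ⟩⟩ C φ
  rw [h₂, h C φ] at h₁
  exact (Option.some.inj h₁).symm

/-- Faces of cells. -/
noncomputable def Cell.face {k l : Globe n} (f : k ⟶ l) (q : Cell X l) : Cell X k :=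
  .mk (.face f q.term) (fun C φ => C.cells.map f.op (q.val C φ))
    (fun C φ => by simp [eval, q.eval_term])

@[simp] lemma Cell.val_face {k l : Globe n} (f : k ⟶ l) (q : Cell X l) (C : StrictNCat.{u} n)
    (φ : X ⟶ C.cells) : (q.face f).val C φ = C.cells.map f.op (q.val C φ) := Cell.val_mk ..

/-- The underlying globular set of the free strict `n`-category on `X`. -/
noncomputable def cells (X : NGlob.{u} n) : NGlob.{u} n where
  obj k := Cell X k.unop
  map f := TypeCat.ofHom fun q => q.face f.unop
  map_id k := by
    ext q
    exact Cell.ext fun C φ => by simp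
  map_comp f g := by
    ext q
    exact Cell.ext fun C φ => by simp

/-- The value of a cell of the free strict `n`-category under an interpretation. -/
noncomputable def val {k : Globe n} (q : (cells X).cell k) (C : StrictNCat.{u} n)
    (φ : X ⟶ C.cells) : C.cells.cell k := Cell.val q C φ

/-- A representing expression. -/
noncomputable def term {k : Globe n} (q : (cells X).cell k) : Term X k := Cell.term q

lemma eval_term {k : Globe n} (q : (cells X).cell k) (C : StrictNCat.{u} n)
    (φ : X ⟶ C.cells) : eval C φ (term q) = some (val q C φ) := Cell.eval_term ..

lemma ext {k : Globe n} {q r : (cells X).cell k}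
    (h : ∀ (C : StrictNCat.{u} n) (φ : X ⟶ C.cells), val q C φ = val r C φ) : q = r :=
  Cell.ext h

lemma val_map {k l : Globe n} (f : k ⟶ l) (q : (cells X).cell l) (C : StrictNCat.{u} n)
    (φ : X ⟶ C.cells) : val ((cells X).map f.op q) C φ = C.cells.map f.op (val q C φ) :=
  Cell.val_face ..

lemma val_src {k l : Globe n} (h : k.dim < l.dim) (q : (cells X).cell l) (C : StrictNCat.{u} n)
    (φ : X ⟶ C.cells) : val ((cells X).src h q) C φ = C.cells.src h (val q C φ) :=
  val_map ..

lemma val_tgt {k l : Globe n} (h : k.dim < l.dim) (q : (cells X).cell l) (C : StrictNCat.{u} n)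
    (φ : X ⟶ C.cells) : val ((cells X).tgt h q) C φ = C.cells.tgt h (val q C φ) :=
  val_map ..

lemma val_composable {k l : Globe n} {h : k.dim < l.dim} {q r : (cells X).cell l}
    (e : (cells X).tgt h q = (cells X).src h r) (C : StrictNCat.{u} n) (φ : X ⟶ C.cells) :
    C.cells.tgt h (val q C φ) = C.cells.src h (val r C φ) := by
  rw [← val_tgt, ← val_src, e]

/-- The generating cells. -/
def var {k : Globe n} (x : X.cell k) : (cells X).cell k :=
  Cell.mk (.var x) (fun _ φ => φ.app _ x) (fun _ _ => rfl)

/-- Identity cells. -/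
noncomputable def ident {k l : Globe n} (h : k.dim < l.dim) (q : (cells X).cell k) :
    (cells X).cell l :=
  Cell.mk (.ident h (term q)) (fun C φ => C.ident h (val q C φ))
    (fun C φ => by simp [eval, eval_term])

/-- Composite cells. -/
noncomputable def comp {k l : Globe n} (h : k.dim < l.dim) (q r : (cells X).cell l)
    (e : (cells X).tgt h q = (cells X).src h r) : (cells X).cell l :=
  Cell.mk (.comp h (term q) (term r))
    (fun C φ => C.comp h (val q C φ) (val r C φ) (val_composable e C φ))
    (fun C φ => by simp [eval, eval_term, val_composable e C φ])

lemma val_var {k : Globe n} (x : X.cell k) (C : StrictNCat.{u} n)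
    (φ : X ⟶ C.cells) : val (var x) C φ = φ.app _ x := Cell.val_mk ..

lemma val_ident {k l : Globe n} (h : k.dim < l.dim) (q : (cells X).cell k) (C : StrictNCat.{u} n)
    (φ : X ⟶ C.cells) : val (ident h q) C φ = C.ident h (val q C φ) := Cell.val_mk ..

lemma val_comp {k l : Globe n} (h : k.dim < l.dim) (q r : (cells X).cell l)
    (e : (cells X).tgt h q = (cells X).src h r) (C : StrictNCat.{u} n)
    (φ : X ⟶ C.cells) : val (comp h q r e) C φ =
      C.comp h (val q C φ) (val r C φ) (val_composable e C φ) := Cell.val_mk ..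

lemma comp_congr (C : StrictNCat.{u} n) {k l : Globe n} (h : k.dim < l.dim)
    {x x' y y' : C.cells.cell l} (e : C.cells.tgt h x = C.cells.src h y) (hx : x = x')
    (hy : y = y') : C.comp h x y e = C.comp h x' y' (by rw [← hx, ← hy, e]) := by
  subst hx hy
  rfl

/-- The free strict `n`-category on `X`. -/
noncomputable def strictNCat (X : NGlob.{u} n) : StrictNCat.{u} n where
  cells := cells X
  ident h q := Free.ident h q
  comp h q r e := Free.comp h q r e
  src_ident h q := Free.ext fun C φ => by rw [val_src, val_ident, C.src_ident]
  tgt_ident h q := Free.ext fun C φ => by rw [val_tgt, val_ident, C.tgt_ident]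
  ident_ident h h' q := Free.ext fun C φ => by simp only [val_ident, C.ident_ident]
  src_comp h q r e := Free.ext fun C φ => by rw [val_src, val_comp, C.src_comp, val_src]
  tgt_comp h q r e := Free.ext fun C φ => by rw [val_tgt, val_comp, C.tgt_comp, val_tgt]
  src_comp_of_lt h h' q r e e' := Free.ext fun C φ => by
    have := val_composable e' C φ
    simp only [val_src] at this
    rw [val_src, val_comp, val_comp, C.src_comp_of_lt h h' _ _ _ this]
    exact comp_congr C h _ (val_src ..).symm (val_src ..).symm
  tgt_comp_of_lt h h' q r e e' := Free.ext fun C φ => by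
    have := val_composable e' C φ
    simp only [val_tgt] at this
    rw [val_tgt, val_comp, val_comp, C.tgt_comp_of_lt h h' _ _ _ this]
    exact comp_congr C h _ (val_tgt ..).symm (val_tgt ..).symm
  assoc h x y z e₁ e₂ e₃ e₄ := Free.ext fun C φ => by
    have e₃' := val_composable e₃ C φ
    have e₄' := val_composable e₄ C φ
    simp only [val_comp] at e₃' e₄' ⊢
    exact C.assoc h _ _ _ _ _ e₃' e₄'
  ident_comp h x e := Free.ext fun C φ => by
    have e' := val_composable e C φ
    simp only [val_comp, val_ident, val_src] at e' ⊢
    exact C.ident_comp h _ e'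
  comp_ident h x e := Free.ext fun C φ => by
    have e' := val_composable e C φ
    simp only [val_comp, val_ident, val_tgt] at e' ⊢
    exact C.comp_ident h _ e'
  interchange h h' x y x' y' e₁ e₂ e₃ e₄ e₅ e₆ := Free.ext fun C φ => by
    have e₅' := val_composable e₅ C φ
    have e₆' := val_composable e₆ C φ
    simp only [val_comp] at e₅' e₆' ⊢
    exact C.interchange h h' _ _ _ _ _ _ _ _ e₅' e₆'
  ident_comp_ident h h' x y e e' := Free.ext fun C φ => by
    have e'' := val_composable e' C φ
    simp only [val_comp, val_ident] at e'' ⊢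
    exact C.ident_comp_ident h h' _ _ _ e''

/-- The inclusion of generators. -/
def unit (X : NGlob.{u} n) : X ⟶ (strictNCat X).cells where
  app k := TypeCat.ofHom fun x => var (k := k.unop) x
  naturality k l f := by
    ext x
    refine Free.ext (k := l.unop) fun C φ => ?_
    refine (val_var ..).trans (Eq.trans ?_ (val_map f.unop (var x) C φ).symm)
    rw [val_var]
    exact NatTrans.naturality_apply φ f x

/-- The strict `n`-functor induced by a map of globular sets. -/
noncomputable def desc (C : StrictNCat.{u} n) (φ : X ⟶ C.cells) : strictNCat X ⟶ C :=
  StrictNCat.Hom.mk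
    { app := fun k => TypeCat.ofHom fun q => val (k := k.unop) q C φ
      naturality := fun k l f => by
        ext q
        exact val_map f.unop q C φ }
    (fun h q => val_ident h q C φ)
    (fun h q r e _ => val_comp h q r e C φ)

lemma unit_desc (C : StrictNCat.{u} n) (φ : X ⟶ C.cells) :
    unit X ≫ (StrictNCat.forget n).map (desc C φ) = φ := by
  ext k x
  exact val_var (k := k.unop) x C φ

lemma desc_unique {C : StrictNCat.{u} n} {φ : X ⟶ C.cells} (F : strictNCat X ⟶ C)
    (hF : unit X ≫ (StrictNCat.forget n).map F = φ) : F = desc C φ := by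
  apply StrictNCat.Hom.ext
  ext k q
  obtain ⟨q', hq'⟩ := Cell.valid (k := k.unop) q (strictNCat X) (unit X)
  have key : ∀ (D : StrictNCat.{u} n) (ψ : X ⟶ D.cells) (G : strictNCat X ⟶ D),
      unit X ≫ (StrictNCat.forget n).map G = ψ →
      (StrictNCat.Hom.map G).app k q' = val (k := k.unop) q D ψ := by
    rintro D ψ G rfl
    exact Option.some.inj ((eval_hom (unit X) G _ _ hq').symm.trans (eval_term ..))
  have hq : q' = q := Free.ext fun D ψ => key D ψ (desc D ψ) (unit_desc D ψ)
  subst hq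
  exact key C φ F hF

end Free

/-- The forgetful functor from strict `n`-categories to `n`-globular sets has a left adjoint. -/
instance (n : ℕ∞) : (StrictNCat.forget.{u} n).IsRightAdjoint :=
  haveI : ∀ X : NGlob.{u} n, HasInitial (StructuredArrow X (StrictNCat.forget.{u} n)) :=
    fun X => IsInitial.hasInitial (X := StructuredArrow.mk (S := X) (T := StrictNCat.forget.{u} n)
      (Y := Free.strictNCat X) (Free.unit X)) <|
      IsInitial.ofUniqueHom
        (fun Y => StructuredArrow.homMk (Free.desc Y.right Y.hom) (Free.unit_desc _ _))
        (fun Y m => by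
          ext1
          exact Free.desc_unique _ (StructuredArrow.w m))
  isRightAdjointOfStructuredArrowInitials _

/-! ### `n`-operads -/

/-- The strict `n`-category monad `𝒯_{≤n}` on `n`-globular sets: the monad of the adjunction
between the free strict `n`-category functor and the forgetful functor. -/
noncomputable def strictNCatMonad (n : ℕ∞) : Monad (NGlob.{u} n) :=
  (Adjunction.ofIsRightAdjoint (StrictNCat.forget.{u} n)).toMonad

/-- An `n`-operad: a monad `A` on `n`-globular sets with a cartesian monad morphism to the strict
`n`-category monad, i.e. a monad morphism all of whose naturality squares are pullbacks. Its
algebras are the algebras of the monad `A`. -/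
structure NOperad (n : ℕ∞) where
  monad : Monad (NGlob.{u} n)
  toStrict : monad ⟶ strictNCatMonad.{u} n
  cartesian : NatTrans.Equifibered (MonadHom.toNatTrans toStrict)

end Glob

/-
A `κ`-c-filtered category is a disjoint union of `κ`-filtered ones, so that an object `C` which is
connected and `κ`-presentable factors every morphism from `C` to a `κ`-c-filtered colimit through
the diagram. If such objects form a small strong generator of a cocomplete category, their closure
under connected colimits of size less than `κ` is therefore dense; its slices are `κ`-c-filtered
and its objects are again connected and `κ`-presentable, so the category is locally
`κ`-c-presentable.

In the category of algebras of `T`, the free algebras on a strong generator form a strong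
generator, and they are connected and `κ`-presentable as the forgetful functor preserves coproducts
and `κ`-filtered colimits. Colimits of algebras exist because the nerve with respect to the free
algebras on `κ`-presentable objects identifies the algebras with the presheaves orthogonal to a
small set of morphisms, and these presheaves form a reflective subcategory.

The operations of a strict `n`-category are defined on cells and on composable pairs of cells, that
is, on finite connected limits of sets of cells. Such limits commute with filtered colimits and with
coproducts, so the free strict `n`-category monad preserves both. This passes to an operad along its
equifibered transformation to that monad, and representables are a strong generator of connected and
finitely presentable globular sets.
-/

namespace CPres

/-! ### Pseudofiltered and `κ`-c-filtered categories -/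

section Pseudofiltered

/-- A category is pseudofiltered when spans can be completed to commutative squares and parallel
pairs can be coequalized, that is, when its connected components are filtered. Filtered and
discrete categories are pseudofiltered, so that pseudofiltered colimits cover filtered colimits
and coproducts at once. -/
class IsPseudofiltered (J : Type u) [Category.{v} J] : Prop where
  span {i j k : J} (f : i ⟶ j) (g : i ⟶ k) :
    ∃ (l : J) (f' : j ⟶ l) (g' : k ⟶ l), f ≫ f' = g ≫ g'
  coeq {i j : J} (f g : i ⟶ j) : ∃ (k : J) (h : j ⟶ k), f ≫ h = g ≫ h

variable {J : Type u} [Category.{v} J]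

instance isPseudofiltered_of_isFiltered [IsFiltered J] : IsPseudofiltered J where
  span f g := IsFiltered.span f g
  coeq f g := ⟨_, IsFiltered.coeqHom f g, IsFiltered.coeq_condition f g⟩

instance isPseudofiltered_discrete (ι : Type u) : IsPseudofiltered (Discrete ι) where
  span {i j k} f g := by
    obtain rfl := Discrete.ext (Discrete.eq_of_hom f)
    obtain rfl := Discrete.ext (Discrete.eq_of_hom g)
    exact ⟨i, 𝟙 _, 𝟙 _, Subsingleton.elim _ _⟩
  coeq _ _ := ⟨_, 𝟙 _, Subsingleton.elim _ _⟩

lemma IsPseudofiltered.exists_hom_hom_of_zigzag [IsPseudofiltered J] {i j : J} (h : Zigzag i j) :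
    ∃ k, Nonempty (i ⟶ k) ∧ Nonempty (j ⟶ k) := by
  induction h with
  | refl => exact ⟨i, ⟨𝟙 _⟩, ⟨𝟙 _⟩⟩
  | tail _ h ih =>
    obtain ⟨k, ⟨a⟩, ⟨b⟩⟩ := ih
    rcases h with ⟨⟨f⟩⟩ | ⟨⟨f⟩⟩
    · obtain ⟨m, b', f', -⟩ := IsPseudofiltered.span b f
      exact ⟨m, ⟨a ≫ b'⟩, ⟨f'⟩⟩
    · exact ⟨k, ⟨a⟩, ⟨f ≫ b⟩⟩

end Pseudofiltered

lemma hasCardinalLT_arrow_widePushoutShape {ι : Type w} {κ : Cardinal.{w}}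
    (hι : HasCardinalLT ι κ) (hκ : Cardinal.aleph0 ≤ κ) :
    HasCardinalLT (Arrow (WidePushoutShape ι)) κ := by
  let φ : Option (Option ι) ⊕ ι → Arrow (WidePushoutShape ι)
    | .inl none => Arrow.mk (𝟙 (show WidePushoutShape ι from none))
    | .inl (some a) => Arrow.mk (𝟙 (show WidePushoutShape ι from a))
    | .inr i => Arrow.mk (WidePushoutShape.Hom.init i)
  refine HasCardinalLT.of_surjective ?_ φ ?_
  · simp only [hasCardinalLT_sum_iff _ _ _ hκ, hasCardinalLT_option_iff _ _ hκ]
    exact ⟨hι, hι⟩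
  · rintro ⟨a, b, (_ | i)⟩
    · rcases a with _ | i
      · exact ⟨.inl none, rfl⟩
      · exact ⟨.inl (some (some i)), rfl⟩
    · exact ⟨.inr i, rfl⟩

instance isConnected_walkingParallelFamily (ι : Type*) [Nonempty ι] :
    IsConnected (WalkingParallelFamily ι) := by
  have : Nonempty (WalkingParallelFamily ι) := ⟨.zero⟩
  refine IsConnected.of_induct (j₀ := .zero) fun p h₀ h j => ?_
  rcases j with _ | _
  · exact h₀
  · exact (h (WalkingParallelFamily.Hom.line (Classical.arbitrary ι))).1 h₀

namespace IsCardinalCFiltered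

variable {J : Type u} [Category.{v} J] (κ : Cardinal.{w}) [hκ : Fact κ.IsRegular]
  [IsCardinalCFiltered J κ]

lemma cocone_nonempty {A : Type*} [Category A] [IsConnected A] (F : A ⥤ J)
    (hA : HasCardinalLT (Arrow A) κ) : Nonempty (Cocone F) := by
  have := hA.small
  have := small_of_small_arrow.{w} A
  have := locallySmall_of_small_arrow.{w} A
  let e := (Shrink.equivalence.{w} A).trans (ShrinkHoms.equivalence.{w} (Shrink.{w} A))
  have := isConnected_of_equivalent e
  exact ⟨(Cocone.equivalenceOfReindexing e.symm (Iso.refl _)).inverse.obj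
    (nonempty_cocone (κ := κ) (e.inverse ⋙ F) (by simpa)).some⟩

lemma of_equivalence {J' : Type*} [Category J'] (e : J ≌ J') : IsCardinalCFiltered J' κ where
  nonempty_cocone F hA := ⟨e.inverse.mapCoconeInv (cocone_nonempty κ (F ⋙ e.inverse) hA).some⟩

lemma wideSpan {ι : Type w} {j : J} {k : ι → J} (f : ∀ i, j ⟶ k i) (hι : HasCardinalLT ι κ) :
    ∃ (m : J) (a : ∀ i, k i ⟶ m) (b : j ⟶ m), ∀ i, f i ≫ a i = b := by
  obtain ⟨c⟩ := cocone_nonempty κ (WidePushoutShape.wideSpan j k f)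
    (hasCardinalLT_arrow_widePushoutShape hι hκ.out.aleph0_le)
  exact ⟨c.pt, fun i => c.ι.app (some i), c.ι.app none, fun i => c.w (.init i)⟩

lemma coeq {ι : Type w} [Nonempty ι] {j k : J} (f : ι → (j ⟶ k)) (hι : HasCardinalLT ι κ) :
    ∃ (l : J) (a : k ⟶ l) (b : j ⟶ l), ∀ i, f i ≫ a = b := by
  obtain ⟨c⟩ := cocone_nonempty κ (parallelFamily f)
    (hasCardinalLT_arrow_walkingParallelFamily hι hκ.out.aleph0_le)
  exact ⟨c.pt, c.ι.app .one, c.ι.app .zero, fun i => c.w (.line i)⟩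

end IsCardinalCFiltered

lemma isPseudofiltered_of_isCardinalCFiltered (J : Type u) [Category.{v} J] (κ : Cardinal.{w})
    [hκ : Fact κ.IsRegular] [IsCardinalCFiltered J κ] : IsPseudofiltered J where
  span f g := by
    obtain ⟨c⟩ := IsCardinalCFiltered.cocone_nonempty κ (span f g)
      (hasCardinalLT_of_finite _ _ hκ.out.aleph0_le)
    exact ⟨c.pt, c.ι.app .left, c.ι.app .right,
      (c.w WalkingSpan.Hom.fst).trans (c.w WalkingSpan.Hom.snd).symm⟩
  coeq f g := by
    obtain ⟨c⟩ := IsCardinalCFiltered.cocone_nonempty κ (parallelPair f g)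
      (hasCardinalLT_of_finite _ _ hκ.out.aleph0_le)
    exact ⟨c.pt, c.ι.app .one,
      (c.w WalkingParallelPairHom.left).trans (c.w WalkingParallelPairHom.right).symm⟩

section ConnectedComponents

variable {J : Type u} [Category.{v} J]

lemma objectProperty_of_hom {c : ConnectedComponents J} {j k : J} (f : j ⟶ k)
    (hj : c.objectProperty j) : c.objectProperty k := by
  rw [← show Quotient.mk'' j = c from hj]
  exact Quotient.sound' (Zigzag.of_inv f)

lemma zigzag_obj {c : ConnectedComponents J} (j k : c.Component) : Zigzag j.obj k.obj :=
  Quotient.exact' (j.property.trans k.property.symm)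

/-- The components are directed because zigzags have upper bounds, and these can be amalgamated
over any chosen object of the component. -/
instance isCardinalFiltered_component (κ : Cardinal.{w}) [Fact κ.IsRegular]
    [IsCardinalCFiltered J κ] (c : ConnectedComponents J) :
    IsCardinalFiltered c.Component κ := by
  have := isPseudofiltered_of_isCardinalCFiltered J κ
  rw [isCardinalFiltered_iff]
  constructor
  · intro ι j hι
    let j₀ : c.Component := default
    choose k f g using fun i => IsPseudofiltered.exists_hom_hom_of_zigzag (zigzag_obj j₀ (j i))
    obtain ⟨m, a, b, -⟩ := IsCardinalCFiltered.wideSpan κ (fun i => (f i).some) hι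
    exact ⟨⟨m, objectProperty_of_hom b j₀.property⟩,
      fun i => ⟨ObjectProperty.homMk ((g i).some ≫ a i)⟩⟩
  · intro ι j k f hι
    rcases isEmpty_or_nonempty ι with _ | _
    · obtain ⟨m, ⟨a⟩, ⟨b⟩⟩ := IsPseudofiltered.exists_hom_hom_of_zigzag (zigzag_obj j k)
      exact ⟨⟨m, objectProperty_of_hom a j.property⟩, ObjectProperty.homMk b,
        ObjectProperty.homMk a, fun i => isEmptyElim i⟩
    · obtain ⟨l, a, b, h⟩ := IsCardinalCFiltered.coeq κ (fun i => (f i).hom) hι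
      exact ⟨⟨l, objectProperty_of_hom b j.property⟩, ObjectProperty.homMk a,
        ObjectProperty.homMk b, fun i => by ext; exact h i⟩

end ConnectedComponents

/-! ### Connected objects and strong generators -/

section Components

variable {J : Type*} [Category J] {C : Type*} [Category C] {D : J ⥤ C}
  (s : ∀ c : CategoryTheory.ConnectedComponents J, Cocone (c.ι ⋙ D)) (t : Cofan fun c => (s c).pt)

/-- The cocone over a functor obtained from a cocone over each of its restrictions to the connected
components of the domain, and a cofan under the vertices of these. -/
@[simps]
def coconeOfComponents : Cocone D where
  pt := t.pt
  ι :=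
    { app := fun j => (s (.mk j)).ι.app ⟨j, rfl⟩ ≫ t.inj (.mk j)
      naturality := fun j k f => by
        have transport (c : CategoryTheory.ConnectedComponents J) (hk : c.objectProperty k) :
            (s (.mk k)).ι.app ⟨k, rfl⟩ ≫ t.inj (.mk k) = (s c).ι.app ⟨k, hk⟩ ≫ t.inj c := by
          obtain rfl : .mk k = c := hk
          rfl
        rw [transport (.mk j) (objectProperty_of_hom f rfl)]
        let f' : (⟨j, rfl⟩ : (CategoryTheory.ConnectedComponents.mk j).Component) ⟶
            ⟨k, objectProperty_of_hom f rfl⟩ := ObjectProperty.homMk f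
        have w := (s (.mk j)).w f'
        dsimp [f'] at w ⊢
        rw [reassoc_of% w, Category.comp_id] }

lemma coconeOfComponents_ι (c : CategoryTheory.ConnectedComponents J) (j : c.Component) :
    (coconeOfComponents s t).ι.app j.obj = (s c).ι.app j ≫ t.inj c := by
  obtain ⟨j, rfl⟩ := j
  rfl

/-- A coproduct of colimits over the connected components is a colimit. -/
def isColimitCoconeOfComponents (hs : ∀ c, IsColimit (s c)) (ht : IsColimit t) :
    IsColimit (coconeOfComponents s t) where
  desc r := Cofan.IsColimit.desc ht fun c => (hs c).desc (r.whisker c.ι)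
  fac r j := by
    refine (Category.assoc _ _ _).trans (Eq.trans ?_ ((hs (.mk j)).fac (r.whisker _) ⟨j, rfl⟩))
    exact congr((s (.mk j)).ι.app ⟨j, rfl⟩ ≫ $(Cofan.IsColimit.fac ht
      (fun c => (hs c).desc (r.whisker c.ι)) (.mk j)))
  uniq r m hm := by
    refine Cofan.IsColimit.hom_ext ht _ _ fun c => (hs c).hom_ext fun j => ?_
    have h := hm j.obj
    rw [coconeOfComponents_ι] at h
    refine ((Category.assoc _ _ _).symm.trans h).trans ?_
    simp

end Components

section Connected

variable {V : Type u} [Category.{w} V]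

lemma isConnectedObject_iff_bijective (C : V) : IsConnectedObject C ↔
    ∀ ⦃ι : Type w⦄ ⦃X : ι → V⦄ (t : Cofan X), IsColimit t →
      Function.Bijective (fun f : Σ i, (C ⟶ X i) => f.2 ≫ t.inj f.1) := by
  have isColimit_mapCocone_iff {ι : Type w} {X : ι → V} (t : Cofan X) :
      Nonempty (IsColimit ((coyoneda.obj (op C)).mapCocone t)) ↔
        Function.Bijective (fun f : Σ i, (C ⟶ X i) => f.2 ≫ t.inj f.1) := by
    rw [(Cofan.isColimitMapCoconeEquiv (coyoneda.obj (op C)) X t).nonempty_congr]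
    exact Cofan.nonempty_isColimit_iff_bijective_fromSigma
      (Cofan.mk (f := fun i => (coyoneda.obj (op C)).obj (X i)) _
        fun i => (coyoneda.obj (op C)).map (t.inj i))
  refine ⟨fun h ι X t ht => ?_, fun h ι => ⟨fun {K} => ?_⟩⟩
  · have := h ι
    exact (isColimit_mapCocone_iff t).1 ⟨isColimitOfPreserves _ ht⟩
  · have : PreservesColimit (Discrete.functor (K.obj ∘ Discrete.mk)) (coyoneda.obj (op C)) :=
      ⟨fun {t} ht => (isColimit_mapCocone_iff t).2 (h t ht)⟩
    exact preservesColimit_of_iso_diagram _ Discrete.natIsoFunctor.symm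

lemma IsConnectedObject.of_iso {C D : V} (e : C ≅ D) (hC : IsConnectedObject C) :
    IsConnectedObject D := fun ι =>
  have := hC ι
  preservesColimitsOfShape_of_natIso (coyoneda.mapIso e.symm.op)

/-- A morphism out of the colimit into a coproduct restricts, over each object of the diagram, to a
morphism into one summand, and the index of that summand is constant by connectedness. -/
lemma isConnectedObject_of_isColimit {A : Type*} [Category A] [IsConnected A] {F : A ⥤ V}
    {c : Cocone F} (hc : IsColimit c) (hF : ∀ a, IsConnectedObject (F.obj a)) :
    IsConnectedObject c.pt := by
  rw [isConnectedObject_iff_bijective]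
  intro ι X t ht
  have hF' a := (isConnectedObject_iff_bijective _).1 (hF a) t ht
  constructor
  · rintro ⟨i, f⟩ ⟨j, g⟩ h
    have e (a : A) : (⟨i, c.ι.app a ≫ f⟩ : Σ i, (F.obj a ⟶ X i)) = ⟨j, c.ι.app a ≫ g⟩ :=
      (hF' a).1 (by simpa using congr(c.ι.app a ≫ $h))
    obtain rfl : i = j := congr_arg Sigma.fst (e (Classical.arbitrary A))
    obtain rfl : f = g := hc.hom_ext fun a => by simpa using e a
    rfl
  · intro f
    choose x hx using fun a => (hF' a).2 (c.ι.app a ≫ f)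
    have x_naturality {a b : A} (φ : a ⟶ b) : x a = ⟨(x b).1, F.map φ ≫ (x b).2⟩ :=
      (hF' a).1 (by simp [hx])
    obtain ⟨i, hi⟩ : ∃ i, ∀ a, ∃ g : F.obj a ⟶ X i, g ≫ t.inj i = c.ι.app a ≫ f := by
      refine ⟨(x (Classical.arbitrary A)).1, fun a => ?_⟩
      rw [← constant_of_preserves_morphisms (fun a => (x a).1)
        (fun a b φ => congr_arg Sigma.fst (x_naturality φ)) a]
      exact ⟨_, hx a⟩
    choose g hg using hi
    refine ⟨⟨i, hc.desc (Cocone.mk _ { app := g, naturality := fun a b φ => ?_ })⟩,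
      hc.hom_ext fun a => ?_⟩
    · have : (⟨i, F.map φ ≫ g b⟩ : Σ i, (F.obj a ⟶ X i)) = ⟨i, g a⟩ := (hF' a).1 (by simp [hg])
      simpa using this
    · simp [hg]

/-- The objects which are connected and `κ`-presentable. -/
def isCPresentable (V : Type u) [Category.{w} V] (κ : Cardinal.{w}) [Fact κ.IsRegular] :
    ObjectProperty V :=
  fun X => IsConnectedObject X ∧ IsCardinalPresentable X κ

variable {κ : Cardinal.{w}} [Fact κ.IsRegular]

lemma isCPresentable_of_iso {C D : V} (e : C ≅ D) (hC : isCPresentable V κ C) :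
    isCPresentable V κ D :=
  have := hC.2
  ⟨hC.1.of_iso e, isCardinalPresentable_of_iso e κ⟩

lemma isCPresentable_of_isColimit {A : Type w} [SmallCategory A] [IsConnected A]
    (hA : HasCardinalLT (Arrow A) κ) {F : A ⥤ V} {c : Cocone F} (hc : IsColimit c)
    (hF : ∀ a, isCPresentable V κ (F.obj a)) : isCPresentable V κ c.pt :=
  have (a : A) : IsCardinalPresentable (F.obj a) κ := (hF a).2
  ⟨isConnectedObject_of_isColimit hc fun a => (hF a).1,
    isCardinalPresentable_of_isColimit _ hc κ hA⟩

/-- A `κ`-c-filtered colimit is the coproduct of the `κ`-filtered colimits over its connected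
components. -/
lemma exists_fac_of_isColimit_of_small [HasColimitsOfSize.{w, w} V] {C : V}
    (hC : isCPresentable V κ C) {J : Type w} [SmallCategory J] [IsCardinalCFiltered J κ]
    {D : J ⥤ V} {s : Cocone D} (hs : IsColimit s) (f : C ⟶ s.pt) :
    ∃ (j : J) (g : C ⟶ D.obj j), g ≫ s.ι.app j = f := by
  have := hC.2
  let s' (c : CategoryTheory.ConnectedComponents J) := colimit.cocone (c.ι ⋙ D)
  let t : Cofan fun c => (s' c).pt := colimit.cocone _
  let hs' := isColimitCoconeOfComponents s' t (fun c => colimit.isColimit _) (colimit.isColimit _)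
  let e := hs.coconePointUniqueUpToIso hs'
  obtain ⟨⟨c, g⟩, hg : g ≫ t.inj c = f ≫ e.hom⟩ :=
    ((isConnectedObject_iff_bijective C).1 hC.1 t (colimit.isColimit _)).2 (f ≫ e.hom)
  obtain ⟨j, g', rfl⟩ := IsCardinalPresentable.exists_hom_of_isColimit κ (colimit.isColimit _) g
  refine ⟨j.obj, g', (cancel_mono e.hom).1 (Eq.trans ?_ hg)⟩
  have he : s.ι.app j.obj ≫ e.hom = (s' c).ι.app j ≫ t.inj c :=
    (hs.comp_coconePointUniqueUpToIso_hom hs' j.obj).trans (coconeOfComponents_ι s' t c j)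
  rw [Category.assoc, he]
  exact (Category.assoc _ _ _).symm

lemma exists_fac_of_isColimit [HasColimitsOfSize.{w, w} V] {C : V}
    (hC : isCPresentable V κ C) {J : Type*} [Category J] [EssentiallySmall.{w} J]
    [IsCardinalCFiltered J κ] {D : J ⥤ V} {s : Cocone D} (hs : IsColimit s) (f : C ⟶ s.pt) :
    ∃ (j : J) (g : C ⟶ D.obj j), g ≫ s.ι.app j = f := by
  let e := equivSmallModel.{w} J
  have := IsCardinalCFiltered.of_equivalence κ e
  obtain ⟨j, g, hg⟩ := exists_fac_of_isColimit_of_small hC (hs.whiskerEquivalence e.symm) f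
  exact ⟨_, g, hg⟩

end Connected

section ConnectedColimitsClosure

variable {V : Type u} [Category.{w} V]

/-- The closure of a property of objects under colimits of connected diagrams with fewer than `κ`
arrows. -/
def connectedColimitsClosure (κ : Cardinal.{w}) (P : ObjectProperty V) : ObjectProperty V :=
  P.colimitsClosure (fun A : { A : SmallCategoryCardinalLT κ //
    IsConnected (SmallCategoryCardinalLT.categoryFamily κ A) } =>
      SmallCategoryCardinalLT.categoryFamily κ A.1)

variable (κ : Cardinal.{w}) (P : ObjectProperty V)

lemma le_connectedColimitsClosure : P ≤ connectedColimitsClosure κ P :=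
  P.le_colimitsClosure _

instance essentiallySmall_connectedColimitsClosure [ObjectProperty.EssentiallySmall.{w} P] :
    ObjectProperty.EssentiallySmall.{w} (connectedColimitsClosure κ P) := by
  dsimp only [connectedColimitsClosure]
  infer_instance

lemma isClosedUnderColimitsOfShape_connectedColimitsClosure (A : Type*) [Category A]
    [IsConnected A] (hA : HasCardinalLT (Arrow A) κ) :
    (connectedColimitsClosure κ P).IsClosedUnderColimitsOfShape A := by
  obtain ⟨S, ⟨e⟩⟩ := SmallCategoryCardinalLT.exists_equivalence κ A hA
  have := isConnected_of_equivalent e.symm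
  rw [← ObjectProperty.isClosedUnderColimitsOfShape_iff_of_equivalence _ e]
  let shapes (A : { A : SmallCategoryCardinalLT κ //
    IsConnected (SmallCategoryCardinalLT.categoryFamily κ A) }) :=
      SmallCategoryCardinalLT.categoryFamily κ A.1
  exact (inferInstance : (P.colimitsClosure shapes).IsClosedUnderColimitsOfShape
    (shapes ⟨S, this⟩))

variable [Fact κ.IsRegular]

instance isCardinalCFiltered_costructuredArrow_connectedColimitsClosure_ι
    [HasColimitsOfSize.{w, w} V] (X : V) :
    IsCardinalCFiltered (CostructuredArrow (connectedColimitsClosure κ P).ι X) κ where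
  nonempty_cocone {A} _ _ K hA := ⟨by
    have := isClosedUnderColimitsOfShape_connectedColimitsClosure κ P A hA
    exact colimit.cocone K⟩

variable {κ P}

lemma connectedColimitsClosure_le_isCPresentable (hP : P ≤ isCPresentable V κ) :
    connectedColimitsClosure κ P ≤ isCPresentable V κ := by
  intro X hX
  induction hX with
  | of_mem X hX => exact hP X hX
  | of_isoClosure e _ h => exact isCPresentable_of_iso e h
  | @of_colimitPresentation X A p _ h =>
    have := A.2
    exact isCPresentable_of_isColimit A.1.hasCardinalLT p.isColimit h

end ConnectedColimitsClosure

section Dense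

variable {K : Type*} [Category K] {V : Type*} [Category V] (i : K ⥤ V)

/-- The cocone with vertex `X` under the diagram of all morphisms from objects `i.obj k` to `X`. It
is the cocone in the definition of density of `i`, without the identities occurring there. -/
@[simps]
def canonicalCocone (X : V) : Cocone (CostructuredArrow.proj i X ⋙ i) where
  pt := X
  ι :=
    { app := fun j => j.hom
      naturality := fun _ _ f => (CostructuredArrow.w f).trans (Category.comp_id _).symm }

/-- The canonical cocone is isomorphic to the one which defines density. -/
def canonicalCoconeIso (X : V) :
    (Functor.LeftExtension.mk _ i.rightUnitor.inv).coconeAt X ≅ canonicalCocone i X :=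
  Cocone.ext (Iso.refl _) fun _ => (Category.comp_id _).trans (Category.id_comp _)

lemma isDense_of_isColimit (h : ∀ X, IsColimit (canonicalCocone i X)) : i.IsDense where
  isDenseAt X := ⟨(h X).ofIsoColimit (canonicalCoconeIso i X).symm⟩

/-- If `i` is dense, the canonical cocone is a colimit. -/
noncomputable def isColimitCanonicalCocone [i.IsDense] (X : V) :
    IsColimit (canonicalCocone i X) :=
  IsColimit.ofIsoColimit (i.denseAt X) (canonicalCoconeIso i X)

section Restriction

variable [i.IsDense] {W : Type*} [Category W] (G : V ⥤ W) {X : V}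
  [PreservesColimitsOfShape (CostructuredArrow i X) G] {Y : W}

lemma hom_ext_of_isDense {f g : G.obj X ⟶ Y}
    (h : ∀ (k : K) (x : i.obj k ⟶ X), G.map x ≫ f = G.map x ≫ g) : f = g :=
  (isColimitOfPreserves G (isColimitCanonicalCocone i X)).hom_ext fun j => h _ j.hom

lemma exists_desc_of_isDense (φ : ∀ k : K, (i.obj k ⟶ X) → (G.obj (i.obj k) ⟶ Y))
    (hφ : ∀ {k l : K} (g : k ⟶ l) (x : i.obj l ⟶ X),
      φ k (i.map g ≫ x) = G.map (i.map g) ≫ φ l x) :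
    ∃ f : G.obj X ⟶ Y, ∀ (k : K) (x : i.obj k ⟶ X), G.map x ≫ f = φ k x := by
  let s : Cocone ((CostructuredArrow.proj i X ⋙ i) ⋙ G) := Cocone.mk Y
    { app := fun j => φ _ j.hom
      naturality := fun j j' f => by
        have := hφ f.left j'.hom
        rw [CostructuredArrow.w f] at this
        exact this.symm.trans (Category.comp_id _).symm }
  have hG := isColimitOfPreserves G (isColimitCanonicalCocone i X)
  exact ⟨hG.desc s, fun k x => hG.fac s (CostructuredArrow.mk x)⟩

end Restriction

/-- The canonical map from the colimit of the canonical diagram to `X` is surjective on generalized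
elements from `P` as `P ≤ Q`, and injective since such an element `g` of the colimit can only be the
coprojection at its own image in `X`. -/
lemma isDense_ι_of_isStrongGenerator {P Q : ObjectProperty V} (hP : P.IsStrongGenerator)
    (hPQ : P ≤ Q) [∀ X, HasColimitsOfShape (CostructuredArrow Q.ι X) V]
    (hfac : ∀ (X G : V), P G → ∀ g : G ⟶ colimit (CostructuredArrow.proj Q.ι X ⋙ Q.ι),
      ∃ j g', g' ≫ colimit.ι (CostructuredArrow.proj Q.ι X ⋙ Q.ι) j = g) : Q.ι.IsDense := by
  refine isDense_of_isColimit _ fun X => ?_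
  let Φ := CostructuredArrow.proj Q.ι X ⋙ Q.ι
  let c := canonicalCocone Q.ι X
  let δ : colimit Φ ⟶ X := colimit.desc Φ c
  let obj {G : V} (hG : P G) (f : G ⟶ X) : CostructuredArrow Q.ι X :=
    CostructuredArrow.mk (show Q.ι.obj ⟨G, hPQ _ hG⟩ ⟶ X from f)
  have eq_ι {G : V} (hG : P G) (g : G ⟶ colimit Φ) : g = colimit.ι Φ (obj hG (g ≫ δ)) := by
    obtain ⟨j, g, rfl⟩ := hfac X G hG g
    have h : g ≫ j.hom = (g ≫ colimit.ι Φ j) ≫ δ :=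
      congr(g ≫ $((colimit.ι_desc c j).symm)).trans (Category.assoc _ _ _).symm
    exact colimit.w Φ (CostructuredArrow.homMk (ObjectProperty.homMk g) h :
      obj hG ((g ≫ colimit.ι Φ j) ≫ δ) ⟶ j)
  have : Mono δ := by
    rw [hP.isSeparating.mono_iff]
    intro G hG g₁ g₂ h
    rw [eq_ι hG g₁, eq_ι hG g₂, h]
  have : IsIso δ := hP.isIso_of_mono δ fun G hG g =>
    ⟨colimit.ι Φ (obj hG g), colimit.ι_desc c _⟩
  exact (colimit.isColimit Φ).ofPointIso (t := c) (i := this)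

end Dense

section StrongGenerator

variable {V : Type u} [Category.{w} V] {κ : Cardinal.{w}} [Fact κ.IsRegular]
  {P : ObjectProperty V} [ObjectProperty.EssentiallySmall.{w} P]

lemma isLocallyCPresentable_of_isDense [HasColimitsOfSize.{w, w} V]
    (hP : P ≤ isCPresentable V κ) [P.ι.IsDense]
    [∀ X, IsCardinalCFiltered (CostructuredArrow P.ι X) κ] : IsLocallyCPresentable V κ where
  cocomplete := inferInstance
  exists_generator := by
    obtain ⟨Q, _, hQP, hPQ⟩ := ObjectProperty.EssentiallySmall.exists_small_le.{w} P
    refine ⟨Q, inferInstance, fun X hX => hP X (hQP X hX), fun X => ?_⟩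
    let e := equivSmallModel.{w} (CostructuredArrow P.ι X)
    refine ⟨SmallModel.{w} (CostructuredArrow P.ι X), inferInstance,
      IsCardinalCFiltered.of_equivalence κ e, ?_⟩
    rw [← ObjectProperty.colimitsOfShape, ← ObjectProperty.colimitsOfShape_isoClosure]
    refine ObjectProperty.colimitsOfShape_monotone _ hPQ _ ⟨?_⟩
    exact
      { diag := _
        ι := _
        isColimit := (isColimitCanonicalCocone P.ι X).whiskerEquivalence e.symm
        prop_diag_obj := fun j => (e.inverse.obj j).left.property }

theorem isLocallyCPresentable_of_isStrongGenerator [HasColimitsOfSize.{w, w} V]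
    (hP : P.IsStrongGenerator) (hPκ : P ≤ isCPresentable V κ) : IsLocallyCPresentable V κ := by
  let Q := connectedColimitsClosure κ P
  have (X : V) : HasColimitsOfShape (CostructuredArrow Q.ι X) V :=
    hasColimitsOfShape_of_equivalence (equivSmallModel.{w} _).symm
  have : Q.ι.IsDense := isDense_ι_of_isStrongGenerator hP (le_connectedColimitsClosure κ P)
    fun X G hG g => exists_fac_of_isColimit (hPκ G hG) (colimit.isColimit _) g
  exact isLocallyCPresentable_of_isDense (connectedColimitsClosure_le_isCPresentable hPκ)

end StrongGenerator

/-! ### The nerve theorem -/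

section FreeHomEquiv

variable {V : Type u} [Category.{w} V] {T : Monad V}

/-- The free-forgetful adjunction on hom sets, phrased in terms of the underlying object of an
algebra. -/
def freeHomEquiv (X : V) (A : T.Algebra) : (T.free.obj X ⟶ A) ≃ (X ⟶ A.A) :=
  T.adj.homEquiv X A

variable {X Y : V} {A B : T.Algebra}

lemma freeHomEquiv_comp (y : T.free.obj X ⟶ A) (f : A ⟶ B) :
    freeHomEquiv X B (y ≫ f) = freeHomEquiv X A y ≫ f.f :=
  T.adj.homEquiv_naturality_right y f

lemma freeHomEquiv_map_comp (g : X ⟶ Y) (y : T.free.obj Y ⟶ A) :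
    freeHomEquiv X A (T.free.map g ≫ y) = g ≫ freeHomEquiv Y A y :=
  T.adj.homEquiv_naturality_left g y

lemma map_freeHomEquiv_comp_a (y : T.free.obj X ⟶ A) :
    T.map (freeHomEquiv X A y) ≫ A.a = y.f := by
  let f : T.obj X ⟶ A.A := y.f
  have hy : freeHomEquiv X A y = T.η.app X ≫ f :=
    (T.adj.homEquiv_unit X A y).trans congr($(T.adj_unit).app X ≫ f)
  have hf : T.map f ≫ A.a = T.μ.app X ≫ f := y.h
  rw [hy, T.map_comp, Category.assoc, hf]
  exact T.right_unit_assoc X f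

lemma freeHomEquiv_symm_f (x : X ⟶ A.A) : ((freeHomEquiv X A).symm x).f = T.map x ≫ A.a := by
  rw [← map_freeHomEquiv_comp_a, Equiv.apply_symm_apply]

lemma freeHomEquiv_id (X : V) : freeHomEquiv X (T.free.obj X) (𝟙 _) = T.η.app X :=
  (T.adj.homEquiv_id X).trans congr($(T.adj_unit).app X)

end FreeHomEquiv

section FreeAlgebras

variable {K : Type*} [Category K] {V : Type u} [Category.{w} V] (T : Monad V) (i : K ⥤ V)

/-- The category of free algebras on the objects `i.obj k`, with the objects `k` of `K` as
objects. -/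
abbrev FreeAlgebras := InducedCategory T.Algebra fun k => T.free.obj (i.obj k)

namespace FreeAlgebras

/-- The functor sending an object `k` of `K` to the free algebra on `i.obj k`. -/
def free : K ⥤ FreeAlgebras T i where
  obj k := k
  map g := InducedCategory.homMk (T.free.map (i.map g))
  map_id k := by
    ext
    simp
  map_comp f g := by
    ext
    simp

/-- The nerve functor sending an algebra `A` to the presheaf of morphisms from free algebras
to `A`. -/
abbrev nerve : T.Algebra ⥤ (FreeAlgebras T i)ᵒᵖ ⥤ Type w :=
  yoneda ⋙ (Functor.whiskeringLeft _ _ _).obj (inducedFunctor _).op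

/-- A morphism from the free algebra on `i.obj k` to `A` is a morphism from `i.obj k` to the
underlying object of `A`. -/
def freeOpCompNerveObj (A : T.Algebra) :
    (free T i).op ⋙ (nerve T i).obj A ≅ i.op ⋙ yoneda.obj A.A :=
  NatIso.ofComponents (fun k => (freeHomEquiv (i.obj k.unop) A).toIso) fun g => by
    ext x
    exact freeHomEquiv_map_comp (i.map g.unop) x

section Dense

variable [i.IsDense]

instance : (nerve T i).Faithful where
  map_injective {A B} f g h := by
    ext
    refine hom_ext_of_isDense i (𝟭 V) fun k x => ?_
    obtain ⟨y, rfl⟩ := (freeHomEquiv (i.obj k) A).surjective x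
    have hy : y ≫ f = y ≫ g := congr(($h).app (op ((free T i).obj k)) y)
    exact (freeHomEquiv_comp y f).symm.trans ((congrArg _ hy).trans (freeHomEquiv_comp y g))

variable [∀ X, PreservesColimitsOfShape (CostructuredArrow i X) T.toFunctor] {T}

lemma exists_algebraHom_comp_eq {A B : T.Algebra}
    (Φ : ∀ k : K, (T.free.obj (i.obj k) ⟶ A) → (T.free.obj (i.obj k) ⟶ B))
    (hΦ : ∀ {j k : K} (y : T.free.obj (i.obj j) ⟶ T.free.obj (i.obj k))
      (x : T.free.obj (i.obj k) ⟶ A), Φ j (y ≫ x) = y ≫ Φ k x) :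
    ∃ f : A ⟶ B, ∀ (k : K) (x : T.free.obj (i.obj k) ⟶ A), x ≫ f = Φ k x := by
  have hf : ∃ f : A.A ⟶ B.A, ∀ (k : K) (x : T.free.obj (i.obj k) ⟶ A),
      freeHomEquiv _ A x ≫ f = freeHomEquiv _ B (Φ k x) := by
    obtain ⟨f, hf⟩ := exists_desc_of_isDense i (𝟭 V) (X := A.A)
      (fun k x => freeHomEquiv _ B (Φ k ((freeHomEquiv _ A).symm x))) fun {j k} g x => by
        obtain ⟨y, rfl⟩ := (freeHomEquiv (i.obj k) A).surjective x
        dsimp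
        rw [← freeHomEquiv_map_comp, Equiv.symm_apply_apply, Equiv.symm_apply_apply, hΦ,
          freeHomEquiv_map_comp]
    exact ⟨f, fun k x => by simpa using hf k (freeHomEquiv _ A x)⟩
  obtain ⟨f, hf⟩ := hf
  have comp_f {k : K} (x : T.free.obj (i.obj k) ⟶ A) : x.f ≫ f = (Φ k x).f := by
    refine hom_ext_of_isDense i (𝟭 V) fun j g => ?_
    obtain ⟨y, rfl⟩ := (freeHomEquiv (i.obj j) (T.free.obj (i.obj k))).surjective g
    have := hf j (y ≫ x)
    rwa [hΦ, freeHomEquiv_comp, freeHomEquiv_comp, Category.assoc] at this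
  refine ⟨{ f := f, h := hom_ext_of_isDense i T.toFunctor fun l x => ?_ }, fun k x => ?_⟩
  · obtain ⟨y, rfl⟩ := (freeHomEquiv (i.obj l) A).surjective x
    rw [← T.map_comp_assoc, hf, map_freeHomEquiv_comp_a, ← comp_f]
    exact (congrArg (fun g : T.obj (i.obj l) ⟶ A.A => g ≫ f)
      (map_freeHomEquiv_comp_a y).symm).trans (Category.assoc _ _ _)
  · ext
    exact comp_f x

instance : (nerve T i).Full where
  map_surjective {A B} α := by
    obtain ⟨f, hf⟩ := exists_algebraHom_comp_eq i (fun k x => α.app (op ((free T i).obj k)) x)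
      fun {j k} y x => NatTrans.naturality_apply α
        (InducedCategory.homMk y : (free T i).obj j ⟶ (free T i).obj k).op x
    exact ⟨f, by ext k x; exact hf k.unop x⟩

end Dense

variable {T}

/-- The morphism of free algebras which corresponds to a morphism `f` under the adjunction. -/
def lift {k l : K} (f : i.obj k ⟶ T.obj (i.obj l)) : (free T i).obj k ⟶ (free T i).obj l :=
  InducedCategory.homMk ((freeHomEquiv _ (T.free.obj (i.obj l))).symm f)

lemma lift_hom_f {k l : K} (f : i.obj k ⟶ T.obj (i.obj l)) :
    (lift i f).hom.f = T.map f ≫ T.μ.app (i.obj l) :=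
  freeHomEquiv_symm_f (A := T.free.obj (i.obj l)) f

lemma lift_unit (k : K) : lift i (T.η.app (i.obj k)) = 𝟙 ((free T i).obj k) :=
  InducedCategory.hom_ext ((Equiv.symm_apply_eq _).2 (freeHomEquiv_id (i.obj k)).symm)

lemma lift_comp {j k l : K} (f : i.obj j ⟶ T.obj (i.obj k))
    (g : (free T i).obj k ⟶ (free T i).obj l) : lift i f ≫ g = lift i (f ≫ g.hom.f) :=
  InducedCategory.hom_ext <| (Equiv.eq_symm_apply _).2 <| (freeHomEquiv_comp _ g.hom).trans
    congr($(Equiv.apply_symm_apply (freeHomEquiv _ (T.free.obj (i.obj k))) f) ≫ g.hom.f)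

lemma lift_comp_lift {j k l : K} (f : i.obj j ⟶ T.obj (i.obj k))
    (g : i.obj k ⟶ T.obj (i.obj l)) :
    lift i f ≫ lift i g = lift i (f ≫ T.map g ≫ T.μ.app (i.obj l)) := by
  rw [lift_comp]
  exact congr(lift i (f ≫ $(lift_hom_f i g)))

lemma lift_comp_free_map {j k l : K} (f : i.obj j ⟶ T.obj (i.obj k)) (g : k ⟶ l) :
    lift i f ≫ (free T i).map g = lift i (f ≫ T.map (i.map g)) :=
  lift_comp i f _

lemma free_map_comp_lift {j k l : K} (g : j ⟶ k) (f : i.obj k ⟶ T.obj (i.obj l)) :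
    (free T i).map g ≫ lift i f = lift i (i.map g ≫ f) :=
  InducedCategory.hom_ext <| (Equiv.eq_symm_apply _).2 <| (freeHomEquiv_map_comp _ _).trans
    congr(i.map g ≫ $(Equiv.apply_symm_apply (freeHomEquiv _ (T.free.obj (i.obj l))) f))

section Dense

variable {i} [i.IsDense] [∀ X, PreservesColimitsOfShape (CostructuredArrow i X) T.toFunctor]
  {P : (FreeAlgebras T i)ᵒᵖ ⥤ Type w} {X : V}

lemma exists_structureMap (e : (free T i).op ⋙ P ≅ i.op ⋙ yoneda.obj X) :
    ∃ a : T.obj X ⟶ X, ∀ {k l : K} (f : i.obj k ⟶ T.obj (i.obj l)) (x : i.obj l ⟶ X),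
      f ≫ T.map x ≫ a = e.hom.app (op k) (P.map (lift i f).op (e.inv.app (op l) x)) := by
  have exists_m (l : K) (x : i.obj l ⟶ X) : ∃ m : T.obj (i.obj l) ⟶ X,
      ∀ (k : K) (f : i.obj k ⟶ T.obj (i.obj l)),
        f ≫ m = e.hom.app (op k) (P.map (lift i f).op (e.inv.app (op l) x)) := by
    refine exists_desc_of_isDense i (𝟭 V)
      (fun k f => e.hom.app (op k) (P.map (lift i f).op (e.inv.app (op l) x)))
      fun {j k} g f => ?_
    rw [← free_map_comp_lift, op_comp, Functor.map_comp_apply]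
    exact NatTrans.naturality_apply e.hom g.op (P.map (lift i f).op (e.inv.app (op l) x))
  choose m hm using exists_m
  obtain ⟨a, ha⟩ := exists_desc_of_isDense i T.toFunctor (X := X) m fun {k l} g x => by
    refine hom_ext_of_isDense i (𝟭 V) fun j (f : i.obj j ⟶ T.obj (i.obj k)) => ?_
    have hx : e.inv.app (op k) (i.map g ≫ x) =
        P.map ((free T i).map g).op (e.inv.app (op l) x) :=
      NatTrans.naturality_apply e.inv g.op x
    dsimp
    rw [hm, ← Category.assoc, hm, hx, ← lift_comp_free_map, op_comp, Functor.map_comp_apply]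
  exact ⟨a, fun f x => by rw [ha, hm]⟩

/-- The part of the nerve theorem for monads with arities describing the essential image. The laws
for the structure map of `X` are checked on morphisms from objects of `K`, by density. -/
lemma mem_essImage_nerve (e : (free T i).op ⋙ P ≅ i.op ⋙ yoneda.obj X) :
    (nerve T i).essImage P := by
  obtain ⟨a, ha⟩ := exists_structureMap e
  let A : T.Algebra :=
    { A := X
      a := a
      unit := by
        refine hom_ext_of_isDense i (𝟭 V) fun k x => ?_
        dsimp
        rw [T.unit_naturality_assoc, ha, lift_unit]
        simp
      assoc := by
        refine hom_ext_of_isDense i (T.toFunctor ⋙ T.toFunctor) fun l x => ?_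
        refine hom_ext_of_isDense i T.toFunctor fun k (f : i.obj k ⟶ T.obj (i.obj l)) => ?_
        refine hom_ext_of_isDense i (𝟭 V) fun j (g : i.obj j ⟶ T.obj (i.obj k)) => ?_
        dsimp
        rw [T.mu_naturality_assoc, ← T.map_comp_assoc (T.map x), ← T.map_comp_assoc f, ha f, ha g]
        have := ha (g ≫ T.map f ≫ T.μ.app (i.obj l)) x
        rw [← lift_comp_lift] at this
        simpa using this }
  refine ⟨A, ⟨NatIso.ofComponents
    (fun k => (freeHomEquiv (i.obj k.unop) A).toIso ≪≫ (e.app (op k.unop)).symm) ?_⟩⟩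
  intro l k f
  ext y
  let g : i.obj k.unop ⟶ T.obj (i.obj l.unop) := freeHomEquiv _ _ f.unop.hom
  have hg : lift i g = f.unop := InducedCategory.hom_ext (Equiv.symm_apply_apply _ _)
  have hy : freeHomEquiv (i.obj k.unop) A (f.unop.hom ≫ y) =
      e.hom.app _ (P.map f (e.inv.app _ (freeHomEquiv _ A y))) := by
    rw [freeHomEquiv_comp, ← map_freeHomEquiv_comp_a]
    refine (ha g _).trans ?_
    rw [hg]
    rfl
  exact (congrArg (e.inv.app (op k.unop)) hy).trans
    (Iso.hom_inv_id_apply (e.app (op k.unop)) _)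

end Dense

end FreeAlgebras

end FreeAlgebras

/-! ### Cocompleteness of categories of algebras -/

section Orthogonality

variable (κ : Cardinal.{w}) {K : Type w} [SmallCategory K] {V : Type u}
  [Category.{w} V] (i : K ⥤ V) {E : Type v} [Category.{w} E]
  (H : K ⥤ E)

/-- The index type of the diagrams in `K` with fewer than `κ` arrows equipped with a cocone that is
sent to a colimit cocone by `i`. -/
structure SmallColimitCocone where
  shape : SmallCategoryCardinalLT κ
  diag : SmallCategoryCardinalLT.categoryFamily κ shape ⥤ K
  cocone : Cocone diag
  isColimit : Nonempty (IsColimit (i.mapCocone cocone))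

section Comparisons

variable [HasColimitsOfSize.{w, w} E]

/-- The comparison morphisms from the colimit of `D ⋙ H` to the value of `H` at the vertex of a
cocone under `D`, for the diagrams `D` with fewer than `κ` arrows and the cocones that are sent to
colimit cocones by `i`. The objects which are local for them are those which see these cocones as
colimits. -/
noncomputable def comparisons : MorphismProperty E :=
  MorphismProperty.ofHoms fun s : SmallColimitCocone κ i =>
    colimit.desc (s.diag ⋙ H) (H.mapCocone s.cocone)

instance : MorphismProperty.IsSmall.{w} (comparisons κ i H) := by
  unfold comparisons
  infer_instance

lemma isLocal_comparisons_iff (P : E) : (comparisons κ i H).isLocal P ↔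
    ∀ (s : SmallColimitCocone κ i) (t : s.diag ⋙ H ⟶ (Functor.const _).obj P),
      ∃! y : H.obj s.cocone.pt ⟶ P, ∀ a, H.map (s.cocone.ι.app a) ≫ y = t.app a := by
  have comp_eq_desc_iff (s : SmallColimitCocone κ i) (t : s.diag ⋙ H ⟶ (Functor.const _).obj P)
      (y : H.obj s.cocone.pt ⟶ P) :
      colimit.desc (s.diag ⋙ H) (H.mapCocone s.cocone) ≫ y = colimit.desc _ (Cocone.mk P t) ↔
        ∀ a, H.map (s.cocone.ι.app a) ≫ y = t.app a := by
    refine ⟨fun h a => ?_, fun h => colimit.hom_ext fun a => ?_⟩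
    · simpa using colimit.ι (s.diag ⋙ H) a ≫= h
    · simpa using h a
  refine ⟨fun h s t => ?_, fun h => ?_⟩
  · simp only [← comp_eq_desc_iff]
    exact (h _ (MorphismProperty.ofHoms.mk s)).existsUnique _
  · rintro _ _ _ ⟨s⟩
    rw [Function.bijective_iff_existsUnique]
    intro b
    obtain ⟨t, rfl⟩ : ∃ t, b = colimit.desc (s.diag ⋙ H) (Cocone.mk P t) :=
      ⟨(colimit.cocone _).ι ≫ (Functor.const _).map b, colimit.hom_ext fun a => by simp⟩
    simp only [comp_eq_desc_iff]
    exact h s t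

variable {κ i H} in
lemma isLocal_comparisons_of_iso {P : E} {X : V} (e : H.op ⋙ yoneda.obj P ≅ i.op ⋙ yoneda.obj X) :
    (comparisons κ i H).isLocal P := by
  rw [isLocal_comparisons_iff]
  intro s t
  have hs := s.isColimit.some
  let φ (k : K) : (H.obj k ⟶ P) ≃ (i.obj k ⟶ X) := (e.app (op k)).toEquiv
  have hφ {k l : K} (g : k ⟶ l) (x : H.obj l ⟶ P) : φ k (H.map g ≫ x) = i.map g ≫ φ l x :=
    NatTrans.naturality_apply e.hom g.op x
  let d : Cocone (s.diag ⋙ i) := Cocone.mk X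
    { app := fun a => φ _ (t.app a)
      naturality := fun a b f => by
        have ht : H.map (s.diag.map f) ≫ t.app b = t.app a :=
          (t.naturality f).trans (Category.comp_id _)
        exact (hφ _ _).symm.trans ((congrArg _ ht).trans (Category.comp_id _).symm) }
  refine ⟨(φ _).symm (hs.desc d), fun a => (φ _).injective ?_, fun y hy => ?_⟩
  · exact (hφ _ _).trans ((congrArg _ (Equiv.apply_symm_apply _ _)).trans (hs.fac d a))
  · refine (Equiv.eq_symm_apply _).2 ?_
    exact hs.uniq d _ fun a => (hφ _ y).symm.trans (congrArg _ (hy a))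

variable [Fact κ.IsRegular]

lemma hasColimits_isLocal_comparisons (hH : ∀ k, IsCardinalPresentable (H.obj k) κ) :
    HasColimitsOfSize.{w, w} (comparisons κ i H).isLocal.FullSubcategory := by
  have isCardinalPresentable ⦃X Y : E⦄ (f : X ⟶ Y) (hf : comparisons κ i H f) :
      IsCardinalPresentable X κ ∧ IsCardinalPresentable Y κ := by
    obtain ⟨s⟩ := hf
    have (a : SmallCategoryCardinalLT.categoryFamily κ s.shape) :
        IsCardinalPresentable ((s.diag ⋙ H).obj a) κ := hH _
    exact ⟨isCardinalPresentable_of_isColimit _ (colimit.isColimit (s.diag ⋙ H)) κ s.shape.2,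
      hH _⟩
  have := MorphismProperty.isRightAdjoint_ι_isLocal (comparisons κ i H) κ isCardinalPresentable
  let : Reflective (comparisons κ i H).isLocal.ι :=
    { L := _
      adj := Adjunction.ofIsRightAdjoint _ }
  exact ⟨fun J _ => hasColimitsOfShape_of_reflective (comparisons κ i H).isLocal.ι⟩

variable {κ i} in
lemma isCardinalFiltered_costructuredArrow_of_isLocal
    (hi : ∀ (S : SmallCategoryCardinalLT κ) (D : SmallCategoryCardinalLT.categoryFamily κ S ⥤ K),
      ∃ c : Cocone D, Nonempty (IsColimit (i.mapCocone c)))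
    {P : E} (hP : (comparisons κ i H).isLocal P) :
    IsCardinalFiltered (CostructuredArrow H P) κ where
  nonempty_cocone {A _} F hA := by
    obtain ⟨S, ⟨e⟩⟩ := SmallCategoryCardinalLT.exists_equivalence κ A hA
    let G := e.functor ⋙ F
    obtain ⟨c, hc⟩ := hi S (G ⋙ CostructuredArrow.proj H P)
    obtain ⟨y, hy⟩ := ((isLocal_comparisons_iff κ i H P).1 hP ⟨S, _, c, hc⟩
      { app := fun a => (G.obj a).hom
        naturality := fun a b f =>
          (CostructuredArrow.w (G.map f)).trans (Category.comp_id _).symm }).exists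
    let d : Cocone G :=
      { pt := CostructuredArrow.mk y
        ι :=
          { app := fun a => CostructuredArrow.homMk (c.ι.app a) (hy a)
            naturality := fun a b f => by
              ext
              exact c.ι.naturality f } }
    exact ⟨(Cocone.precompose (e.invFunIdAssoc F).inv).obj (d.whisker e.inverse)⟩

end Comparisons

variable [Fact κ.IsRegular]

lemma exists_iso_of_isCardinalFiltered [i.Full] [i.Faithful]
    (hi : ∀ k, IsCardinalPresentable (i.obj k) κ) (P : E)
    [IsCardinalFiltered (CostructuredArrow H P) κ]
    [HasColimit (CostructuredArrow.proj H P ⋙ i)] :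
    ∃ X : V, Nonempty (H.op ⋙ yoneda.obj P ≅ i.op ⋙ yoneda.obj X) := by
  let F := CostructuredArrow.proj H P ⋙ i
  let φ (k : K) (x : H.obj k ⟶ P) : i.obj k ⟶ colimit F := colimit.ι F (CostructuredArrow.mk x)
  have hφ {k l : K} (g : k ⟶ l) (x : H.obj l ⟶ P) : φ k (H.map g ≫ x) = i.map g ≫ φ l x :=
    (colimit.w F (CostructuredArrow.homMk g :
      CostructuredArrow.mk (H.map g ≫ x) ⟶ CostructuredArrow.mk x)).symm
  have φ_injective (k : K) : Function.Injective (φ k) := fun x y h => by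
    obtain ⟨j, a, b, hab⟩ := IsCardinalPresentable.exists_eq_of_isColimit κ (colimit.isColimit F)
      (i₁ := CostructuredArrow.mk x) (i₂ := CostructuredArrow.mk y) (𝟙 (i.obj k)) (𝟙 (i.obj k))
      ((Category.id_comp _).trans (h.trans (Category.id_comp _).symm))
    have hab' : a.left = b.left := i.map_injective
      ((Category.id_comp _).symm.trans (hab.trans (Category.id_comp _)))
    exact (CostructuredArrow.w a).symm.trans
      ((congrArg (H.map · ≫ j.hom) hab').trans (CostructuredArrow.w b))
  have φ_surjective (k : K) : Function.Surjective (φ k) := fun f => by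
    obtain ⟨j, f', hf'⟩ := IsCardinalPresentable.exists_hom_of_isColimit κ (colimit.isColimit F) f
    obtain ⟨g, rfl⟩ := i.map_surjective f'
    exact ⟨H.map g ≫ j.hom, (hφ g j.hom).trans hf'⟩
  exact ⟨colimit F, ⟨NatIso.ofComponents
    (fun k => (Equiv.ofBijective _ ⟨φ_injective k.unop, φ_surjective k.unop⟩).toIso)
    fun g => by ext x; exact hφ g.unop x⟩⟩

end Orthogonality

section Cocomplete

variable {κ : Cardinal.{w}} [Fact κ.IsRegular]

lemma isCardinalPresentable_yoneda_obj {C : Type w} [SmallCategory C] (X : C) :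
    IsCardinalPresentable (yoneda.obj X) κ :=
  ⟨fun _ _ _ => preservesColimitsOfShape_of_natIso
    (NatIso.ofComponents fun _ => yonedaEquiv.toIso :
      coyoneda.obj (op (yoneda.obj X)) ≅ (evaluation Cᵒᵖ (Type w)).obj (op X)).symm⟩

variable {K : Type w} [SmallCategory K] {V : Type u} [Category.{w} V] {i : K ⥤ V}

lemma exists_isColimit_mapCocone [i.Full] [i.Faithful] [HasColimitsOfSize.{w, w} V]
    (hi : i.essImage = isCardinalPresentable V κ) {S : SmallCategoryCardinalLT κ}
    (D : SmallCategoryCardinalLT.categoryFamily κ S ⥤ K) :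
    ∃ c : Cocone D, Nonempty (IsColimit (i.mapCocone c)) := by
  have (a : SmallCategoryCardinalLT.categoryFamily κ S) :
    IsCardinalPresentable ((D ⋙ i).obj a) κ := hi.le _ (i.obj_mem_essImage _)
  obtain ⟨k, ⟨e⟩⟩ := hi.ge _
    (isCardinalPresentable_of_isColimit _ (colimit.isColimit (D ⋙ i)) κ S.2)
  let c : Cocone D :=
    { pt := k
      ι :=
        { app := fun a => i.preimage (colimit.ι (D ⋙ i) a ≫ e.inv)
          naturality := fun a b f => i.map_injective (by
            simpa using colimit.w_assoc (D ⋙ i) f e.inv) } }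
  exact ⟨c, ⟨IsColimit.ofIsoColimit (colimit.isColimit (D ⋙ i))
    (Cocone.ext e.symm fun a => by simp [c])⟩⟩

end Cocomplete

namespace FreeAlgebras

variable {κ : Cardinal.{w}} {K : Type w} [SmallCategory K] {V : Type u} [Category.{w} V]
  {T : Monad V} {i : K ⥤ V}

lemma isLocal_nerve_obj (A : T.Algebra) :
    (comparisons κ i (free T i ⋙ yoneda)).isLocal ((nerve T i).obj A) :=
  isLocal_comparisons_of_iso (Functor.isoWhiskerLeft (free T i).op
    (curriedYonedaLemma'.app ((nerve T i).obj A)) ≪≫ freeOpCompNerveObj T i A)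

variable [Fact κ.IsRegular] [i.Full] [i.Faithful] [i.IsDense] [HasColimitsOfSize.{w, w} V]
  [∀ X, PreservesColimitsOfShape (CostructuredArrow i X) T.toFunctor]

lemma mem_essImage_nerve_of_isLocal (hi : i.essImage = isCardinalPresentable V κ)
    {P : (FreeAlgebras T i)ᵒᵖ ⥤ Type w} (hP : (comparisons κ i (free T i ⋙ yoneda)).isLocal P) :
    (nerve T i).essImage P := by
  have := isCardinalFiltered_costructuredArrow_of_isLocal _
    (fun _ => exists_isColimit_mapCocone hi) hP
  obtain ⟨X, ⟨e⟩⟩ := exists_iso_of_isCardinalFiltered κ i (free T i ⋙ yoneda)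
    (fun k => hi.le _ (i.obj_mem_essImage k)) P
  exact mem_essImage_nerve
    ((Functor.isoWhiskerLeft (free T i).op (curriedYonedaLemma'.app P)).symm ≪≫ e)

lemma hasColimits_algebra_of_isDense (hi : i.essImage = isCardinalPresentable V κ) :
    HasColimitsOfSize.{w, w} T.Algebra := by
  have := hasColimits_isLocal_comparisons κ i (free T i ⋙ yoneda)
    fun k => isCardinalPresentable_yoneda_obj _
  let N := (comparisons κ i (free T i ⋙ yoneda)).isLocal.lift (nerve T i) isLocal_nerve_obj
  have : N.EssSurj := ⟨fun P => by
    obtain ⟨A, ⟨e⟩⟩ := mem_essImage_nerve_of_isLocal hi P.2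
    exact ⟨A, ⟨(ObjectProperty.fullyFaithfulι _).preimageIso e⟩⟩⟩
  have : N.IsEquivalence := { }
  exact ⟨fun J _ => Adjunction.hasColimitsOfShape_of_equivalence N⟩

end FreeAlgebras

theorem hasColimits_algebra (κ : Cardinal.{w}) [Fact κ.IsRegular] {V : Type u} [Category.{w} V]
    [IsCardinalLocallyPresentable V κ] (T : Monad V) [T.toFunctor.IsCardinalAccessible κ] :
    HasColimitsOfSize.{w, w} T.Algebra := by
  let e := equivSmallModel.{w} (isCardinalPresentable V κ).FullSubcategory
  let i := e.inverse ⋙ (isCardinalPresentable V κ).ι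
  have (X : V) : EssentiallySmall.{w} (CostructuredArrow i X) := essentiallySmallSelf _
  have (X : V) : IsCardinalFiltered (CostructuredArrow i X) κ :=
    IsCardinalFiltered.of_equivalence κ
      (CostructuredArrow.pre e.inverse (isCardinalPresentable V κ).ι X).asEquivalence.symm
  have (X : V) := T.preservesColimitsOfShape_of_isCardinalAccessible_of_essentiallySmall κ
    (CostructuredArrow i X)
  have : HasColimitsOfSize.{w, w} V := inferInstance
  have hi : i.essImage = isCardinalPresentable V κ := by
    ext X
    refine ⟨fun ⟨k, ⟨f⟩⟩ => ?_, fun hX => ?_⟩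
    · exact (isCardinalPresentable V κ).prop_of_iso f (e.inverse.obj k).2
    · exact ⟨e.functor.obj ⟨X, hX⟩,
        ⟨(isCardinalPresentable V κ).ι.mapIso (e.unitIso.app ⟨X, hX⟩).symm⟩⟩
  exact FreeAlgebras.hasColimits_algebra_of_isDense hi

/-! ### Algebras of accessible monads preserving coproducts -/

section Adjunction

variable {C : Type u} [Category.{w} C] {D : Type v} [Category.{w} D] {F : C ⥤ D} {G : D ⥤ C}

lemma isConnectedObject_leftAdjoint_obj (adj : F ⊣ G) (hG : PreservesSmallCoproducts G) {X : C}
    (hX : IsConnectedObject X) : IsConnectedObject (F.obj X) := fun ι => by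
  have := hX ι
  have := hG ι
  exact preservesColimitsOfShape_of_natIso
    (show G ⋙ coyoneda.obj (op X) ≅ coyoneda.obj (op (F.obj X)) from
      (adj.compCoyonedaIso.app (op X)).symm)

lemma isStrongGenerator_map_leftAdjoint (adj : F ⊣ G) [G.Faithful] [G.ReflectsIsomorphisms]
    {P : ObjectProperty C} (hP : P.IsStrongGenerator) : (P.map F).IsStrongGenerator := by
  rw [ObjectProperty.isStrongGenerator_iff] at hP ⊢
  refine ⟨fun A B f g h => ?_, fun A B f _ hf => ?_⟩
  · refine G.map_injective (hP.1 _ _ fun X hX x => ?_)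
    have hx := h (F.obj X) (P.prop_map_obj F hX) ((adj.homEquiv X A).symm x)
    rw [← adj.homEquiv_naturality_right_symm, ← adj.homEquiv_naturality_right_symm] at hx
    exact (adj.homEquiv X B).symm.injective hx
  · have := adj.rightAdjoint_preservesLimits
    have : IsIso (G.map f) := hP.2 _ fun X hX x => by
      obtain ⟨y, hy⟩ := hf (F.obj X) (P.prop_map_obj F hX) ((adj.homEquiv X B).symm x)
      exact ⟨adj.homEquiv X A y, (adj.homEquiv_naturality_right y f).symm.trans
        ((adj.homEquiv X B).eq_symm_apply.1 hy)⟩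
    exact isIso_of_reflects_iso f G

end Adjunction

section Algebra

variable {κ : Cardinal.{w}} [Fact κ.IsRegular] {V : Type u} [Category.{w} V]

lemma exists_isStrongGenerator_of_isLocallyCPresentable [IsLocallyCPresentable V κ] :
    ∃ S : ObjectProperty V, ObjectProperty.Small.{w} S ∧ S ≤ isCPresentable V κ ∧
      S.IsStrongGenerator := by
  obtain ⟨S, hS, hSκ, hcolim⟩ := IsLocallyCPresentable.exists_generator (V := V) (κ := κ)
  refine ⟨S, hS, hSκ, .mk_of_exists_colimitsOfShape fun X => ?_⟩
  obtain ⟨J, _, _, hJ⟩ := hcolim X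
  exact ⟨J, _, hJ⟩

instance isCardinalAccessible_forget [HasColimitsOfSize.{w, w} V] (T : Monad V)
    [T.toFunctor.IsCardinalAccessible κ] : T.forget.IsCardinalAccessible κ :=
  ⟨fun J _ _ => by
    have := T.preservesColimitsOfShape_of_isCardinalAccessible κ J
    infer_instance⟩

theorem isLocallyCPresentable_algebra [IsLocallyCPresentable V κ] (T : Monad V)
    [T.toFunctor.IsCardinalAccessible κ] (hT : PreservesSmallCoproducts T.toFunctor) :
    IsLocallyCPresentable T.Algebra κ := by
  have : HasColimitsOfSize.{w, w} V := IsLocallyCPresentable.cocomplete κ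
  obtain ⟨S, _, hSκ, hS⟩ := exists_isStrongGenerator_of_isLocallyCPresentable (V := V) (κ := κ)
  have : IsCardinalLocallyPresentable V κ :=
    (IsCardinalLocallyPresentable.iff_exists_isStrongGenerator V κ).2
      ⟨S, inferInstance, hS, fun X hX => (hSκ X hX).2⟩
  have := hasColimits_algebra κ T
  refine isLocallyCPresentable_of_isStrongGenerator
    (isStrongGenerator_map_leftAdjoint T.adj hS) ?_
  rintro A ⟨X, hX, ⟨e⟩⟩
  have hforget : PreservesSmallCoproducts T.forget := fun ι => by
    have := hT ι
    infer_instance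
  have := (hSκ X hX).2
  exact isCPresentable_of_iso e
    ⟨isConnectedObject_leftAdjoint_obj T.adj hforget (hSκ X hX).1,
      T.adj.isCardinalPresentable_leftAdjoint_obj κ X⟩

end Algebra

/-! ### Pseudofiltered colimits of types and equifibered transformations -/

section Types

variable {J : Type v} [Category.{u} J] {F : J ⥤ Type w} {c : Cocone F}

lemma nonempty_isColimit_of_exists_map_eq_map [HasColimit F]
    (hsurj : ∀ x : c.pt, ∃ (j : J) (y : F.obj j), c.ι.app j y = x)
    (hinj : ∀ {i j : J} (x : F.obj i) (y : F.obj j), c.ι.app i x = c.ι.app j y →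
      ∃ (k : J) (f : i ⟶ k) (g : j ⟶ k), F.map f x = F.map g y) : Nonempty (IsColimit c) := by
  have fac (j : J) (x : F.obj j) : colimit.desc F c (colimit.ι F j x) = c.ι.app j x :=
    congr($(colimit.ι_desc c j) x)
  have : IsIso (colimit.desc F c) := by
    refine (isIso_iff_bijective _).2 ⟨fun x y h => ?_, fun x => ?_⟩
    · obtain ⟨i, x, rfl⟩ := Types.jointly_surjective' x
      obtain ⟨j, y, rfl⟩ := Types.jointly_surjective' y
      rw [fac, fac] at h
      obtain ⟨k, f, g, hfg⟩ := hinj x y h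
      exact Types.colimit_sound' f g hfg
    · obtain ⟨j, y, rfl⟩ := hsurj x
      exact ⟨colimit.ι F j y, fac j y⟩
  exact ⟨IsColimit.ofIsoColimit (colimit.isColimit F)
    (Cocone.ext (asIso (colimit.desc F c)) fun j => colimit.ι_desc c j)⟩

variable [IsPseudofiltered J]

lemma exists_map_eq_map_of_isColimit (hc : IsColimit c) {i j : J} {x : F.obj i} {y : F.obj j}
    (h : c.ι.app i x = c.ι.app j y) :
    ∃ (k : J) (f : i ⟶ k) (g : j ⟶ k), F.map f x = F.map g y := by
  have : HasColimit F := ⟨⟨c, hc⟩⟩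
  have desc_ι (i : J) (x : F.obj i) :
      hc.desc (colimit.cocone F) (c.ι.app i x) = colimit.ι F i x :=
    congr($(hc.fac (colimit.cocone F) i) x)
  have hgen := Types.colimit_eq ((desc_ι i x).symm.trans ((congrArg _ h).trans (desc_ι j y)))
  suffices ∀ (p q : Σ j, F.obj j), Relation.EqvGen F.ColimitTypeRel p q →
      ∃ (k : J) (f : p.1 ⟶ k) (g : q.1 ⟶ k), F.map f p.2 = F.map g q.2 from this _ _ hgen
  intro p q hpq
  induction hpq with
  | rel p q h =>
    obtain ⟨f, hf⟩ := h
    exact ⟨q.1, f, 𝟙 _, by simp [hf]⟩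
  | refl p => exact ⟨p.1, 𝟙 _, 𝟙 _, rfl⟩
  | symm p q _ ih =>
    obtain ⟨k, f, g, h⟩ := ih
    exact ⟨k, g, f, h.symm⟩
  | trans p q r _ _ ih₁ ih₂ =>
    obtain ⟨k₁, f₁, g₁, h₁⟩ := ih₁
    obtain ⟨k₂, f₂, g₂, h₂⟩ := ih₂
    obtain ⟨k, a₁, a₂, ha⟩ := IsPseudofiltered.span g₁ f₂
    refine ⟨k, f₁ ≫ a₁, g₂ ≫ a₂, ?_⟩
    simp only [Functor.map_comp, ConcreteCategory.comp_apply, h₁, ← h₂]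
    simp only [← ConcreteCategory.comp_apply, ← Functor.map_comp, ha]

lemma exists_map_eq_of_isColimit (hc : IsColimit c) {i : J} {x y : F.obj i}
    (h : c.ι.app i x = c.ι.app i y) : ∃ (k : J) (f : i ⟶ k), F.map f x = F.map f y := by
  obtain ⟨k, f, g, hfg⟩ := exists_map_eq_map_of_isColimit hc h
  obtain ⟨l, a, ha⟩ := IsPseudofiltered.coeq f g
  refine ⟨l, f ≫ a, ?_⟩
  conv_rhs => rw [ha]
  simp only [Functor.map_comp, ConcreteCategory.comp_apply, hfg]

end Types

section Equifibered

variable {J : Type w} [Category.{w} J] [IsPseudofiltered J]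

lemma preservesColimitsOfShape_of_equifibered_of_type {C : Type u} [Category.{v} C]
    {G H : C ⥤ Type w} (α : G ⟶ H) (hα : NatTrans.Equifibered α)
    [PreservesColimitsOfShape J H] : PreservesColimitsOfShape J G := by
  refine ⟨fun {F} => ⟨fun {c} hc => nonempty_isColimit_of_exists_map_eq_map (fun x => ?_)
    fun {i j} x y h => ?_⟩⟩
  · obtain ⟨j, y, hy⟩ := Types.jointly_surjective_of_isColimit (isColimitOfPreserves H hc)
      (α.app _ x)
    obtain ⟨z, hz, -⟩ := Types.exists_of_isPullback (hα (c.ι.app j)) x y hy.symm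
    exact ⟨j, z, hz⟩
  · have hH : H.map (c.ι.app i) (α.app _ x) = H.map (c.ι.app j) (α.app _ y) :=
      (α.naturality_apply _ x).symm.trans ((congrArg _ h).trans (α.naturality_apply _ y))
    obtain ⟨k, f, g, hfg⟩ := exists_map_eq_map_of_isColimit (isColimitOfPreserves H hc) hH
    have w {i : J} (f : i ⟶ k) (x : G.obj (F.obj i)) :
        G.map (c.ι.app k) (G.map (F.map f) x) = G.map (c.ι.app i) x :=
      congr($((G.mapCocone c).w f) x)
    exact ⟨k, f, g, Types.ext_of_isPullback (hα (c.ι.app k))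
      ((w f x).trans (h.trans (w g y).symm))
      ((α.naturality_apply _ x).trans (hfg.trans (α.naturality_apply _ y).symm))⟩

theorem preservesColimitsOfShape_of_equifibered {C D : Type*} [Category* C] [Category* D]
    {G H : C ⥤ D ⥤ Type w} (α : G ⟶ H) (hα : NatTrans.Equifibered α)
    [PreservesColimitsOfShape J H] : PreservesColimitsOfShape J G := by
  have (d : D) : PreservesColimitsOfShape J (G ⋙ (evaluation D (Type w)).obj d) :=
    preservesColimitsOfShape_of_equifibered_of_type
      (Functor.whiskerRight α ((evaluation D (Type w)).obj d)) fun _ _ f =>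
        (hα f).map ((evaluation D (Type w)).obj d)
  exact preservesColimitsOfShape_of_evaluation G J this

end Equifibered

/-! ### Presheaf categories -/

section Presheaf

variable {C : Type v} [SmallCategory C] {κ : Cardinal.{max w v}} [Fact κ.IsRegular]

lemma isCPresentable_uliftYoneda_obj (X : C) :
    isCPresentable (Cᵒᵖ ⥤ Type (max w v)) κ (uliftYoneda.{w}.obj X) :=
  let e : (evaluation Cᵒᵖ (Type (max w v))).obj (op X) ≅
      coyoneda.obj (op (uliftYoneda.{w}.obj X)) :=
    NatIso.ofComponents fun _ => uliftYonedaEquiv.toIso.symm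
  ⟨fun _ => preservesColimitsOfShape_of_natIso e,
    ⟨fun _ _ _ => preservesColimitsOfShape_of_natIso e⟩⟩

theorem isLocallyCPresentable_presheaf : IsLocallyCPresentable (Cᵒᵖ ⥤ Type (max w v)) κ := by
  have : Small.{max w v} C := small_max.{w} C
  refine isLocallyCPresentable_of_isStrongGenerator
    (Functor.isStrongGenerator_of_isDense (uliftYoneda.{w} (C := C))) ?_
  rintro _ ⟨X⟩
  exact isCPresentable_uliftYoneda_obj X

end Presheaf

end CPres

namespace Glob

/-! ### Pseudofiltered colimits of strict `n`-categories -/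

open CPres

variable {n : ℕ∞}

namespace NGlob

variable (X : NGlob.{u} n) {k l m : Globe n} (h : k.dim < l.dim) (h' : l.dim < m.dim)

lemma src_src (x : X.cell m) : X.src h (X.src h' x) = X.src (h.trans h') x :=
  congr($(X.map_comp (srcIncl h').op (srcIncl h).op) x).symm

lemma src_tgt (x : X.cell m) : X.src h (X.tgt h' x) = X.src (h.trans h') x :=
  congr($(X.map_comp (tgtIncl h').op (srcIncl h).op) x).symm

lemma tgt_src (x : X.cell m) : X.tgt h (X.src h' x) = X.tgt (h.trans h') x :=
  congr($(X.map_comp (srcIncl h').op (tgtIncl h).op) x).symm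

lemma tgt_tgt (x : X.cell m) : X.tgt h (X.tgt h' x) = X.tgt (h.trans h') x :=
  congr($(X.map_comp (tgtIncl h').op (tgtIncl h).op) x).symm

variable {X}

lemma composable_src {x y : X.cell m} (e : X.tgt (h.trans h') x = X.src (h.trans h') y) :
    X.tgt h (X.src h' x) = X.src h (X.src h' y) := by
  rw [tgt_src, src_src, e]

lemma composable_tgt {x y : X.cell m} (e : X.tgt (h.trans h') x = X.src (h.trans h') y) :
    X.tgt h (X.tgt h' x) = X.src h (X.tgt h' y) := by
  rw [tgt_tgt, src_tgt, e]

lemma src_eq_src_of_composable {x y : X.cell m} (e : X.tgt h' x = X.src h' y) :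
    X.src (h.trans h') x = X.src (h.trans h') y := by
  rw [← X.src_tgt h h', e, src_src]

lemma tgt_eq_tgt_of_composable {x y : X.cell m} (e : X.tgt h' x = X.src h' y) :
    X.tgt (h.trans h') x = X.tgt (h.trans h') y := by
  rw [← X.tgt_tgt h h', e, tgt_src]

end NGlob

namespace StrictNCat

section Composable

variable (C : StrictNCat.{u} n) {k l m : Globe n} (h : k.dim < l.dim) (h' : l.dim < m.dim)

lemma composable_ident {x y : C.cells.cell l} (e : C.cells.tgt h x = C.cells.src h y) :
    C.cells.tgt (h.trans h') (C.ident h' x) = C.cells.src (h.trans h') (C.ident h' y) := by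
  rw [← NGlob.tgt_tgt _ h h', ← NGlob.src_src _ h h', C.tgt_ident, C.src_ident, e]

variable {x y x' y' : C.cells.cell m}

lemma composable_comp (e₁ : C.cells.tgt h' x = C.cells.src h' y)
    (e₂ : C.cells.tgt h' x' = C.cells.src h' y')
    (e₃ : C.cells.tgt (h.trans h') x = C.cells.src (h.trans h') x') :
    C.cells.tgt (h.trans h') (C.comp h' x y e₁) =
      C.cells.src (h.trans h') (C.comp h' x' y' e₂) := by
  rw [← NGlob.tgt_tgt _ h h', C.tgt_comp, NGlob.tgt_tgt, ← NGlob.tgt_eq_tgt_of_composable h h' e₁,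
    ← NGlob.src_src _ h h', C.src_comp, NGlob.src_src, e₃]

lemma composable_comp_of_lt (e₁ : C.cells.tgt h' x = C.cells.src h' y)
    (e₂ : C.cells.tgt h' x' = C.cells.src h' y')
    (e₃ : C.cells.tgt (h.trans h') x = C.cells.src (h.trans h') x')
    (e₄ : C.cells.tgt (h.trans h') y = C.cells.src (h.trans h') y') :
    C.cells.tgt h' (C.comp (h.trans h') x x' e₃) =
      C.cells.src h' (C.comp (h.trans h') y y' e₄) := by
  rw [C.tgt_comp_of_lt h h' x x' e₃ (NGlob.composable_tgt h h' e₃),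
    C.src_comp_of_lt h h' y y' e₄ (NGlob.composable_src h h' e₄)]
  exact Free.comp_congr C h _ e₁ e₂

end Composable

section Colimit

variable {J : Type w} [SmallCategory J] (F : J ⥤ StrictNCat.{w} n)

/-- The action on cells of the transition maps of a diagram of strict `n`-categories. -/
def mapCell {i j : J} (f : i ⟶ j) {k : Globe n} (x : (F.obj i).cells.cell k) :
    (F.obj j).cells.cell k :=
  (StrictNCat.Hom.map (F.map f)).app (op k) x

variable {F}

section

variable {i j : J} (f : i ⟶ j) {k l : Globe n} (h : k.dim < l.dim)

lemma src_mapCell (x : (F.obj i).cells.cell l) :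
    (F.obj j).cells.src h (mapCell F f x) = mapCell F f ((F.obj i).cells.src h x) :=
  (NGlob.map_src _ h x).symm

lemma tgt_mapCell (x : (F.obj i).cells.cell l) :
    (F.obj j).cells.tgt h (mapCell F f x) = mapCell F f ((F.obj i).cells.tgt h x) :=
  (NGlob.map_tgt _ h x).symm

lemma composable_mapCell {x y : (F.obj i).cells.cell l}
    (e : (F.obj i).cells.tgt h x = (F.obj i).cells.src h y) :
    (F.obj j).cells.tgt h (mapCell F f x) = (F.obj j).cells.src h (mapCell F f y) :=
  NGlob.map_composable _ h e

lemma mapCell_ident (x : (F.obj i).cells.cell k) :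
    mapCell F f ((F.obj i).ident h x) = (F.obj j).ident h (mapCell F f x) :=
  StrictNCat.Hom.map_ident _ h x

lemma mapCell_comp (x y : (F.obj i).cells.cell l)
    (e : (F.obj i).cells.tgt h x = (F.obj i).cells.src h y) :
    mapCell F f ((F.obj i).comp h x y e) =
      (F.obj j).comp h (mapCell F f x) (mapCell F f y) (composable_mapCell f h e) :=
  StrictNCat.Hom.map_comp _ h x y e _

end

variable (c : Cocone (F ⋙ forget n))

/-- The action on cells of the legs of a cocone of globular sets under a diagram of strict
`n`-categories. -/
def ιCell (j : J) {k : Globe n} (x : (F.obj j).cells.cell k) : NGlob.cell c.pt k :=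
  NatTrans.app (show (F.obj j).cells ⟶ c.pt from c.ι.app j) (op k) x

variable {c}

lemma ιCell_mapCell {i j : J} (f : i ⟶ j) {k : Globe n} (x : (F.obj i).cells.cell k) :
    ιCell c j (mapCell F f x) = ιCell c i x :=
  congr(NatTrans.app $(c.w f) (op k) x)

lemma src_ιCell (j : J) {k l : Globe n} (h : k.dim < l.dim) (x : (F.obj j).cells.cell l) :
    NGlob.src c.pt h (ιCell c j x) = ιCell c j ((F.obj j).cells.src h x) :=
  (NGlob.map_src (X := (F.obj j).cells) (c.ι.app j) h x).symm

lemma tgt_ιCell (j : J) {k l : Globe n} (h : k.dim < l.dim) (x : (F.obj j).cells.cell l) :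
    NGlob.tgt c.pt h (ιCell c j x) = ιCell c j ((F.obj j).cells.tgt h x) :=
  (NGlob.map_tgt (X := (F.obj j).cells) (c.ι.app j) h x).symm

variable (hc : IsColimit c) {k l m : Globe n} (h : k.dim < l.dim) (h' : l.dim < m.dim)

include hc in
lemma exists_ιCell_eq (x : NGlob.cell c.pt k) :
    ∃ (j : J) (a : (F.obj j).cells.cell k), ιCell c j a = x :=
  Types.jointly_surjective_of_isColimit
    (isColimitOfPreserves ((evaluation _ _).obj (op k)) hc) x

variable [IsPseudofiltered J]

section

include hc

lemma exists_mapCell_eq_mapCell {i j : J} {x : (F.obj i).cells.cell k}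
    {y : (F.obj j).cells.cell k} (e : ιCell c i x = ιCell c j y) :
    ∃ (p : J) (f : i ⟶ p) (g : j ⟶ p), mapCell F f x = mapCell F g y :=
  exists_map_eq_map_of_isColimit (isColimitOfPreserves ((evaluation _ _).obj (op k)) hc) e

lemma exists_mapCell_eq {i : J} {x y : (F.obj i).cells.cell k}
    (e : ιCell c i x = ιCell c i y) : ∃ (j : J) (f : i ⟶ j), mapCell F f x = mapCell F f y :=
  exists_map_eq_of_isColimit (isColimitOfPreserves ((evaluation _ _).obj (op k)) hc) e

lemma exists_composable_mapCell {i : J} (a : (F.obj i).cells.cell l) (y : NGlob.cell c.pt l)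
    (e : NGlob.tgt c.pt h (ιCell c i a) = NGlob.src c.pt h y) :
    ∃ (j : J) (f : i ⟶ j) (b : (F.obj j).cells.cell l), ιCell c j b = y ∧
      (F.obj j).cells.tgt h (mapCell F f a) = (F.obj j).cells.src h b := by
  obtain ⟨i', b, rfl⟩ := exists_ιCell_eq hc y
  rw [tgt_ιCell, src_ιCell] at e
  obtain ⟨j, f, g, hfg⟩ := exists_mapCell_eq_mapCell hc e
  exact ⟨j, f, mapCell F g b, ιCell_mapCell g b, by rw [tgt_mapCell, src_mapCell, hfg]⟩

lemma exists_composable_of_composable {x y : NGlob.cell c.pt l}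
    (e : NGlob.tgt c.pt h x = NGlob.src c.pt h y) :
    ∃ (j : J) (a b : (F.obj j).cells.cell l), ιCell c j a = x ∧ ιCell c j b = y ∧
      (F.obj j).cells.tgt h a = (F.obj j).cells.src h b := by
  obtain ⟨i, a, rfl⟩ := exists_ιCell_eq hc x
  obtain ⟨j, f, b, rfl, hb⟩ := exists_composable_mapCell hc h a y e
  exact ⟨j, mapCell F f a, b, ιCell_mapCell f a, rfl, hb⟩

lemma exists_interchange_square {x y x' y' : NGlob.cell c.pt m}
    (e₁ : NGlob.tgt c.pt h' x = NGlob.src c.pt h' y)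
    (e₂ : NGlob.tgt c.pt h' x' = NGlob.src c.pt h' y')
    (e₃ : NGlob.tgt c.pt (h.trans h') x = NGlob.src c.pt (h.trans h') x') :
    ∃ (j : J) (a b a' b' : (F.obj j).cells.cell m), ιCell c j a = x ∧ ιCell c j b = y ∧
      ιCell c j a' = x' ∧ ιCell c j b' = y' ∧
      (F.obj j).cells.tgt h' a = (F.obj j).cells.src h' b ∧
      (F.obj j).cells.tgt h' a' = (F.obj j).cells.src h' b' ∧
      (F.obj j).cells.tgt (h.trans h') a = (F.obj j).cells.src (h.trans h') a' := by
  obtain ⟨i, a, b, rfl, rfl, hab⟩ := exists_composable_of_composable hc h' e₁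
  obtain ⟨i', f, a', rfl, haa'⟩ := exists_composable_mapCell hc (h.trans h') a x' e₃
  obtain ⟨j, g, b', rfl, ha'b'⟩ := exists_composable_mapCell hc h' a' y' e₂
  exact ⟨j, mapCell F g (mapCell F f a), mapCell F g (mapCell F f b), mapCell F g a', b',
    (ιCell_mapCell ..).trans (ιCell_mapCell ..), (ιCell_mapCell ..).trans (ιCell_mapCell ..),
    ιCell_mapCell .., rfl, composable_mapCell g h' (composable_mapCell f h' hab), ha'b',
    composable_mapCell g _ haa'⟩

lemma ιCell_ident_eq_of_ιCell_eq {i j : J} {x : (F.obj i).cells.cell k}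
    {y : (F.obj j).cells.cell k} (e : ιCell c i x = ιCell c j y) :
    ιCell c i ((F.obj i).ident h x) = ιCell c j ((F.obj j).ident h y) := by
  obtain ⟨p, f, g, hfg⟩ := exists_mapCell_eq_mapCell hc e
  rw [← ιCell_mapCell f, ← ιCell_mapCell g ((F.obj j).ident h y), mapCell_ident, mapCell_ident,
    hfg]

lemma ιCell_comp_eq_of_ιCell_eq {i j : J} {x y : (F.obj i).cells.cell l}
    {x' y' : (F.obj j).cells.cell l} (e : (F.obj i).cells.tgt h x = (F.obj i).cells.src h y)
    (e' : (F.obj j).cells.tgt h x' = (F.obj j).cells.src h y')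
    (hx : ιCell c i x = ιCell c j x') (hy : ιCell c i y = ιCell c j y') :
    ιCell c i ((F.obj i).comp h x y e) = ιCell c j ((F.obj j).comp h x' y' e') := by
  obtain ⟨p, f, g, hfg⟩ := exists_mapCell_eq_mapCell hc hx
  obtain ⟨q, t, ht⟩ := exists_mapCell_eq hc
    ((ιCell_mapCell f y).trans (hy.trans (ιCell_mapCell g y').symm))
  rw [← ιCell_mapCell f, ← ιCell_mapCell t, ← ιCell_mapCell g ((F.obj j).comp h x' y' e'),
    ← ιCell_mapCell t (mapCell F g _), mapCell_comp, mapCell_comp, mapCell_comp, mapCell_comp]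
  exact congrArg _ (Free.comp_congr _ h _ (congrArg _ hfg) ht)

lemma exists_eq_ιCell_ident (x : NGlob.cell c.pt k) :
    ∃ y : NGlob.cell c.pt l, ∀ ⦃j : J⦄ (a : (F.obj j).cells.cell k), ιCell c j a = x →
      y = ιCell c j ((F.obj j).ident h a) := by
  obtain ⟨j, a, rfl⟩ := exists_ιCell_eq hc x
  exact ⟨_, fun i b e => ιCell_ident_eq_of_ιCell_eq hc h e.symm⟩

lemma exists_eq_ιCell_comp {x y : NGlob.cell c.pt l}
    (e : NGlob.tgt c.pt h x = NGlob.src c.pt h y) :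
    ∃ z : NGlob.cell c.pt l, ∀ ⦃j : J⦄ (a b : (F.obj j).cells.cell l)
      (e' : (F.obj j).cells.tgt h a = (F.obj j).cells.src h b), ιCell c j a = x →
        ιCell c j b = y → z = ιCell c j ((F.obj j).comp h a b e') := by
  obtain ⟨j, a, b, rfl, rfl, e'⟩ := exists_composable_of_composable hc h e
  exact ⟨_, fun i a' b' e'' ha hb =>
    ιCell_comp_eq_of_ιCell_eq hc h e' e'' ha.symm hb.symm⟩

end

/-- The identity operations on the colimit of the underlying globular sets of strict
`n`-categories, computed at any stage of the diagram. -/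
noncomputable def colimitIdent (x : NGlob.cell c.pt k) : NGlob.cell c.pt l :=
  (exists_eq_ιCell_ident hc h x).choose

lemma colimitIdent_ιCell {j : J} (a : (F.obj j).cells.cell k) :
    colimitIdent hc h (ιCell c j a) = ιCell c j ((F.obj j).ident h a) :=
  (exists_eq_ιCell_ident hc h _).choose_spec a rfl

/-- The composition operations on the colimit of the underlying globular sets of strict
`n`-categories, computed at any stage of the diagram where the two cells are composable. -/
noncomputable def colimitComp (x y : NGlob.cell c.pt l)
    (e : NGlob.tgt c.pt h x = NGlob.src c.pt h y) : NGlob.cell c.pt l :=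
  (exists_eq_ιCell_comp hc h e).choose

lemma colimitComp_eq {x y : NGlob.cell c.pt l} (e : NGlob.tgt c.pt h x = NGlob.src c.pt h y)
    {j : J} {a b : (F.obj j).cells.cell l}
    (e' : (F.obj j).cells.tgt h a = (F.obj j).cells.src h b)
    (ha : ιCell c j a = x) (hb : ιCell c j b = y) :
    colimitComp hc h x y e = ιCell c j ((F.obj j).comp h a b e') :=
  (exists_eq_ιCell_comp hc h e).choose_spec a b e' ha hb

lemma colimitComp_assoc (x y z : NGlob.cell c.pt l)
    (e₁ : NGlob.tgt c.pt h x = NGlob.src c.pt h y) (e₂ : NGlob.tgt c.pt h y = NGlob.src c.pt h z)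
    (e₃ : NGlob.tgt c.pt h (colimitComp hc h x y e₁) = NGlob.src c.pt h z)
    (e₄ : NGlob.tgt c.pt h x = NGlob.src c.pt h (colimitComp hc h y z e₂)) :
    colimitComp hc h (colimitComp hc h x y e₁) z e₃ =
      colimitComp hc h x (colimitComp hc h y z e₂) e₄ := by
  obtain ⟨i, a, b, rfl, rfl, hab⟩ := exists_composable_of_composable hc h e₁
  obtain ⟨j, f, d, rfl, hbd⟩ := exists_composable_mapCell hc h b z e₂
  have hab' := composable_mapCell f h hab
  rw [colimitComp_eq hc h e₃ (((F.obj j).tgt_comp ..).trans hbd)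
      (colimitComp_eq hc h e₁ hab' (ιCell_mapCell f a) (ιCell_mapCell f b)).symm rfl,
    colimitComp_eq hc h e₄ (hab'.trans ((F.obj j).src_comp ..).symm) (ιCell_mapCell f a)
      (colimitComp_eq hc h e₂ hbd (ιCell_mapCell f b) rfl).symm, (F.obj j).assoc]

lemma colimitComp_interchange (x y x' y' : NGlob.cell c.pt m)
    (e₁ : NGlob.tgt c.pt h' x = NGlob.src c.pt h' y)
    (e₂ : NGlob.tgt c.pt h' x' = NGlob.src c.pt h' y')
    (e₃ : NGlob.tgt c.pt (h.trans h') x = NGlob.src c.pt (h.trans h') x')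
    (e₄ : NGlob.tgt c.pt (h.trans h') y = NGlob.src c.pt (h.trans h') y')
    (e₅ : NGlob.tgt c.pt (h.trans h') (colimitComp hc h' x y e₁) =
      NGlob.src c.pt (h.trans h') (colimitComp hc h' x' y' e₂))
    (e₆ : NGlob.tgt c.pt h' (colimitComp hc (h.trans h') x x' e₃) =
      NGlob.src c.pt h' (colimitComp hc (h.trans h') y y' e₄)) :
    colimitComp hc (h.trans h') (colimitComp hc h' x y e₁) (colimitComp hc h' x' y' e₂) e₅ =
      colimitComp hc h' (colimitComp hc (h.trans h') x x' e₃)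
        (colimitComp hc (h.trans h') y y' e₄) e₆ := by
  obtain ⟨j, a, b, a', b', rfl, rfl, rfl, rfl, hab, ha'b', haa'⟩ :=
    exists_interchange_square hc h h' e₁ e₂ e₃
  have hbb' : (F.obj j).cells.tgt (h.trans h') b = (F.obj j).cells.src (h.trans h') b' := by
    rw [← NGlob.tgt_eq_tgt_of_composable h h' hab, haa',
      NGlob.src_eq_src_of_composable h h' ha'b']
  rw [colimitComp_eq hc _ e₅ ((F.obj j).composable_comp h h' hab ha'b' haa')
      (colimitComp_eq hc h' e₁ hab rfl rfl).symm (colimitComp_eq hc h' e₂ ha'b' rfl rfl).symm,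
    colimitComp_eq hc _ e₆ ((F.obj j).composable_comp_of_lt h h' hab ha'b' haa' hbb')
      (colimitComp_eq hc _ e₃ haa' rfl rfl).symm (colimitComp_eq hc _ e₄ hbb' rfl rfl).symm,
    (F.obj j).interchange h h']

/-- The strict `n`-category carried by the colimit of the underlying globular sets of a
pseudofiltered diagram of strict `n`-categories. -/
noncomputable def colimitNCat : StrictNCat.{w} n where
  cells := c.pt
  ident h x := colimitIdent hc h x
  comp h x y e := colimitComp hc h x y e
  src_ident h x := by
    obtain ⟨j, a, rfl⟩ := exists_ιCell_eq hc x
    rw [colimitIdent_ιCell, src_ιCell, (F.obj j).src_ident]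
  tgt_ident h x := by
    obtain ⟨j, a, rfl⟩ := exists_ιCell_eq hc x
    rw [colimitIdent_ιCell, tgt_ιCell, (F.obj j).tgt_ident]
  ident_ident h h' x := by
    obtain ⟨j, a, rfl⟩ := exists_ιCell_eq hc x
    simp only [colimitIdent_ιCell, (F.obj j).ident_ident]
  src_comp h x y e := by
    obtain ⟨j, a, b, rfl, rfl, e'⟩ := exists_composable_of_composable hc h e
    rw [colimitComp_eq hc h e e' rfl rfl, src_ιCell, src_ιCell, (F.obj j).src_comp]
  tgt_comp h x y e := by
    obtain ⟨j, a, b, rfl, rfl, e'⟩ := exists_composable_of_composable hc h e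
    rw [colimitComp_eq hc h e e' rfl rfl, tgt_ιCell, tgt_ιCell, (F.obj j).tgt_comp]
  src_comp_of_lt h h' x y e e₁ := by
    obtain ⟨j, a, b, rfl, rfl, e'⟩ := exists_composable_of_composable hc _ e
    rw [colimitComp_eq hc _ e e' rfl rfl, colimitComp_eq hc h e₁ (NGlob.composable_src h h' e')
      (src_ιCell ..).symm (src_ιCell ..).symm, src_ιCell, (F.obj j).src_comp_of_lt]
  tgt_comp_of_lt h h' x y e e₁ := by
    obtain ⟨j, a, b, rfl, rfl, e'⟩ := exists_composable_of_composable hc _ e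
    rw [colimitComp_eq hc _ e e' rfl rfl, colimitComp_eq hc h e₁ (NGlob.composable_tgt h h' e')
      (tgt_ιCell ..).symm (tgt_ιCell ..).symm, tgt_ιCell, (F.obj j).tgt_comp_of_lt]
  assoc h := colimitComp_assoc hc h
  ident_comp h x e := by
    obtain ⟨j, a, rfl⟩ := exists_ιCell_eq hc x
    rw [colimitComp_eq hc h e ((F.obj j).tgt_ident h _)
      (by rw [src_ιCell, colimitIdent_ιCell]) rfl, (F.obj j).ident_comp]
  comp_ident h x e := by
    obtain ⟨j, a, rfl⟩ := exists_ιCell_eq hc x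
    rw [colimitComp_eq hc h e ((F.obj j).src_ident h _).symm rfl
      (by rw [tgt_ιCell, colimitIdent_ιCell]), (F.obj j).comp_ident]
  interchange h h' := colimitComp_interchange hc h h'
  ident_comp_ident h h' x y e e' := by
    obtain ⟨j, a, b, rfl, rfl, hab⟩ := exists_composable_of_composable hc h e
    rw [colimitComp_eq hc _ e' ((F.obj j).composable_ident h h' hab)
      (colimitIdent_ιCell hc h' a).symm (colimitIdent_ιCell hc h' b).symm,
      colimitComp_eq hc h e hab rfl rfl, colimitIdent_ιCell, (F.obj j).ident_comp_ident]

end Colimit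

section ColimitCocone

variable {J : Type w} [SmallCategory J] {F : J ⥤ StrictNCat.{w} n}
  {c : Cocone (F ⋙ forget n)} (hc : IsColimit c)

lemma desc_ιCell (s : Cocone F) {j : J} {k : Globe n} (a : (F.obj j).cells.cell k) :
    (hc.desc ((forget n).mapCocone s)).app (op k) (ιCell c j a) =
      (StrictNCat.Hom.map (s.ι.app j)).app (op k) a :=
  congr(NatTrans.app $(hc.fac ((forget n).mapCocone s) j) (op k) a)

variable [IsPseudofiltered J]

/-- The cocone of strict `n`-functors with vertex `colimitNCat`. -/
noncomputable def colimitNCatCocone : Cocone F where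
  pt := colimitNCat hc
  ι :=
    { app := fun j => StrictNCat.Hom.mk (D := colimitNCat hc) (c.ι.app j)
        (fun h x => (colimitIdent_ιCell hc h x).symm)
        (fun h _ _ e e' => (colimitComp_eq hc h e' e rfl rfl).symm)
      naturality := fun _ _ f => StrictNCat.Hom.ext (c.ι.naturality f) }

section

variable {D : StrictNCat.{w} n} {s : ∀ j, F.obj j ⟶ D} {φ : c.pt ⟶ D.cells}
  (hφ : ∀ {j : J} {k : Globe n} (a : (F.obj j).cells.cell k),
    φ.app (op k) (ιCell c j a) = (StrictNCat.Hom.map (s j)).app (op k) a)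
  {k l : Globe n} (h : k.dim < l.dim)

include hφ

lemma app_colimitIdent (x : NGlob.cell c.pt k) :
    φ.app (op l) (colimitIdent hc h x) = D.ident h (φ.app (op k) x) := by
  obtain ⟨j, a, rfl⟩ := exists_ιCell_eq hc x
  rw [colimitIdent_ιCell, hφ, hφ, StrictNCat.Hom.map_ident]

lemma app_colimitComp {x y : NGlob.cell c.pt l} (e : NGlob.tgt c.pt h x = NGlob.src c.pt h y)
    (e' : D.cells.tgt h (φ.app (op l) x) = D.cells.src h (φ.app (op l) y)) :
    φ.app (op l) (colimitComp hc h x y e) = D.comp h (φ.app (op l) x) (φ.app (op l) y) e' := by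
  obtain ⟨j, a, b, rfl, rfl, hab⟩ := exists_composable_of_composable hc h e
  rw [colimitComp_eq hc h e hab rfl rfl, hφ,
    StrictNCat.Hom.map_comp (s j) h a b hab (NGlob.map_composable _ h hab)]
  exact Free.comp_congr _ h _ (hφ a).symm (hφ b).symm

end

/-- The strict `n`-functor out of `colimitNCat` induced by a cocone. -/
noncomputable def colimitNCatDesc (s : Cocone F) : colimitNCat hc ⟶ s.pt :=
  StrictNCat.Hom.mk (C := colimitNCat hc) (hc.desc ((forget n).mapCocone s))
    (fun h _ => app_colimitIdent hc (desc_ιCell hc s) h _)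
    (fun h _ _ e e' => app_colimitComp hc (desc_ιCell hc s) h e e')

/-- `colimitNCatCocone` is a colimit cocone. -/
noncomputable def isColimitColimitNCatCocone : IsColimit (colimitNCatCocone hc) where
  desc s := colimitNCatDesc hc s
  fac s j := StrictNCat.Hom.ext (hc.fac ((forget n).mapCocone s) j)
  uniq s m hm := StrictNCat.Hom.ext (hc.uniq ((forget n).mapCocone s) (StrictNCat.Hom.map m)
    fun j => congrArg StrictNCat.Hom.map (hm j))

end ColimitCocone

variable (J : Type w) [SmallCategory J] [IsPseudofiltered J]

instance preservesColimitsOfShape_forget : PreservesColimitsOfShape J (forget.{w} n) where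
  preservesColimit {F} := preservesColimit_of_preserves_colimit_cocone
    (isColimitColimitNCatCocone (colimit.isColimit (F ⋙ forget n)))
    (IsColimit.ofIsoColimit (colimit.isColimit (F ⋙ forget n)) (Cocone.ext (Iso.refl _)
      fun _ => Category.comp_id _))

end StrictNCat

section Operad

variable (J : Type w) [SmallCategory J] [IsPseudofiltered J]

instance preservesColimitsOfShape_strictNCatMonad :
    PreservesColimitsOfShape J (strictNCatMonad.{w} n).toFunctor :=
  have : PreservesColimitsOfShape J (StrictNCat.forget.{w} n).leftAdjoint :=
    (Adjunction.ofIsRightAdjoint _).leftAdjoint_preservesColimits.preservesColimitsOfShape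
  comp_preservesColimitsOfShape (StrictNCat.forget.{w} n).leftAdjoint (StrictNCat.forget.{w} n)

instance NOperad.preservesColimitsOfShape (A : NOperad.{w} n) :
    PreservesColimitsOfShape J A.monad.toFunctor :=
  preservesColimitsOfShape_of_equifibered _ A.cartesian

end Operad

theorem NOperad.isLocallyCPresentable_algebra (A : NOperad.{w} n) (κ : Cardinal.{w})
    [Fact κ.IsRegular] : IsLocallyCPresentable A.monad.Algebra κ := by
  have : IsLocallyCPresentable (NGlob.{w} n) κ := isLocallyCPresentable_presheaf.{w, 0}
  have : A.monad.toFunctor.IsCardinalAccessible κ := ⟨fun J _ _ => by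
    have := isFiltered_of_isCardinalFiltered J κ
    infer_instance⟩
  exact CPres.isLocallyCPresentable_algebra A.monad fun ι => inferInstance

end Glob

theorem mainTheorem12 :
    (∀ (κ : Cardinal.{w}) [Fact κ.IsRegular] (V : Type u) [Category.{w} V]
      [CPres.IsLocallyCPresentable V κ] (T : Monad V),
      T.toFunctor.IsCardinalAccessible κ →
      CPres.PreservesSmallCoproducts T.toFunctor →
      CPres.IsLocallyCPresentable T.Algebra κ) ∧
    (∀ (n : ℕ∞) (A : Glob.NOperad.{w} n),
      CPres.IsLocallyFinitelyCPresentable A.monad.Algebra) :=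
  have := Cardinal.fact_isRegular_aleph0.{w}
  ⟨fun _ _ _ _ _ T _ hT => CPres.isLocallyCPresentable_algebra T hT,
    fun _ A => A.isLocallyCPresentable_algebra _⟩
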